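/- Let $r \ge 1$ be an integer. There exists a constant $C = C(r) > 0$ such that for every $0 < p \le 1$ there exists $\varepsilon = \varepsilon(r,p) > 0$ such that, for every fixed finite graph $H_0$ with chromatic number exactly $r$, the binomial random graph $G = G(n,p)$ on $n$ labelled vertices has the following property with probability tending to $1$ as $n \to \infty$. For every spanning subgraph $G' \subseteq G$ with minimum degree $\delta(G') \ge (1 - 1/r)np$ and every set $T \subseteq V(G')$ with $|T| \le \varepsilon n$, all but at most $Cp^{-2}$ vertices of $V(G') \setminus T$ are contained in a (not necessarily induced) copy of $H_0$ in $G'$ that is disjoint from $T$. -/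

import Mathlib

open Filter Topology

namespace SimpleGraph

/-- The vertex `v` of `G` lies in a (not necessarily induced) copy of `H` in `G` none of whose
vertices belongs to `T`. -/
def InCopyAvoiding {V W : Type*} (H : SimpleGraph W) (G : SimpleGraph V) (T : Set V) (v : V) :
    Prop :=
  ∃ f : H.Copy G, v ∈ Set.range f ∧ Disjoint (Set.range f) T

end SimpleGraph

/-- The random graph `G(n, p)` on the vertex set `Fin n` has the property `P`
asymptotically almost surely. -/
def AsymptoticallyAlmostSurely (p : unitInterval) (P : (n : ℕ) → SimpleGraph (Fin n) → Prop) :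
    Prop :=
  Tendsto (fun n : ℕ => SimpleGraph.binomialRandom (Fin n) p {G | P n G}) atTop (𝓝 1)

/-! ### Concentration for sums of independent indicators -/

section Probability

open MeasureTheory ProbabilityTheory

/-! Randomness enters only through `asymptoticallyAlmostSurely_jointNbhdsRegular`: by Hoeffding and
a union bound, all sets of at most `m` vertices of `G` have the expected number of common neighbours
up to a factor `1 ± δ`. The rest is deterministic.

Call `v` rich if at least `c * n ^ r` tuples `(y₀, …, y_{r-1})` are cliques of `G'` with `v`
adjacent to all entries but the last. The last entry is a twin of `v`, standing for its colour
class. Few tuples meet a small set `T ∪ {v}`, and by supersaturation (`exists_blowup_of_dense`) the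
others contain a complete `r`-partite graph with large parts, all but one of them joined to `v`. Any
`r`-colourable `H₀` embeds there with some vertex at `v` (`InCopyAvoiding.of_blowup`). As `c`
depends only on `r` and `p`, so does `ε`.

It remains to bound the number of poor vertices (`exists_card_few_rooted_le`). The case `r = 1` is
trivial; let `r = s + 2` and `q = 1 - 1/r`, and suppose that `B` is a set of slightly more than `C /
p ^ 2` poor vertices. Take a uniformly random ordered `m`-clique `x` of `G`, with `m` large. Its
small marginals are almost uniform (`HasRegularMarginals`). For `v ∈ B` let `Y` be the set of
positions `i` with `x i` a `G'`-neighbour of `v` and with not many more than `m / r` edges from `x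
i` into `x` deleted in `G'`. If `Y` carries an `(r - 1)`-clique of `G'`, its vertices together miss
fewer than `m` positions, so some `x j` is joined to all of them and `x` contains a rooted clique;
this is rare for poor `v`. Otherwise Turán gives `|Y| ^ 2 ≤ s * (m + D)`, where `D` counts the
deleted ordered pairs of `x` inside the `G`-neighbourhood of `v` (`card_sq_le_of_mem_cliqueTuples`).

Now average over `x` and over `v ∈ B` (`averaged_inequality`). By Cauchy–Schwarz the left side is
about `(q p m) ^ 2` or more. On the right, a deleted pair is counted once for each `v ∈ B` joined to
both ends. This codegree is concentrated near `|B| p ^ 2` over the edges of `G`, and at most about a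
`1/r` share of the edges at a vertex is deleted. So `(1 - 1/r) ^ 2 ≤ (r - 2)/r` up to small errors,
which is false by `1/r ^ 2`. The codegree step is what needs `B` to be large, and it only needs `|B|
p ^ 2` above a constant depending on `r`; hence the bound `C(r) / p ^ 2`. -/

/-- Hoeffding's inequality for the number of occurrences among independent events of equal
probability. -/
theorem ProbabilityTheory.iIndepSet.measureReal_abs_sum_indicator_sub_le {Ω ι : Type*}
    {mΩ : MeasurableSpace Ω} {μ : Measure Ω} [IsProbabilityMeasure μ] [Fintype ι] {A : ι → Set Ω}
    (hA : ∀ i, MeasurableSet (A i)) (hind : iIndepSet A μ) {q : ℝ} (hq : ∀ i, μ.real (A i) = q)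
    {t : ℝ} (ht : 0 ≤ t) :
    μ.real {ω | t ≤ |∑ i, (A i).indicator (1 : Ω → ℝ) ω - Fintype.card ι * q|} ≤
      2 * Real.exp (-t ^ 2 / (Fintype.card ι / 2)) := by
  have hI : iIndepFun (fun i => (A i).indicator (1 : Ω → ℝ)) μ := hind.iIndepFun_indicator
  have hmeas : ∀ i, Measurable ((A i).indicator (1 : Ω → ℝ)) := fun i =>
    measurable_one.indicator (hA i)
  have hint : ∀ i, ∫ ω, (A i).indicator (1 : Ω → ℝ) ω ∂μ = q := fun i => by
    rw [integral_indicator_one (hA i), hq]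
  have hsub : ∀ i, HasSubgaussianMGF (fun ω => (A i).indicator (1 : Ω → ℝ) ω - q)
      ((‖(1 : ℝ) - 0‖₊ / 2) ^ 2) μ := fun i => by
    have := hasSubgaussianMGF_of_mem_Icc (μ := μ) (X := (A i).indicator (1 : Ω → ℝ)) (a := 0)
      (b := 1) (hmeas i).aemeasurable (ae_of_all _ fun ω => by
        by_cases h : ω ∈ A i <;> simp [h])
    simpa only [hint] using this
  have hI1 : iIndepFun (fun i ω => (A i).indicator (1 : Ω → ℝ) ω - q) μ :=
    hI.comp (fun _ x => x - q) fun _ => by fun_prop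
  have hI2 : iIndepFun (fun i ω => -((A i).indicator (1 : Ω → ℝ) ω - q)) μ :=
    hI.comp (fun _ x => -(x - q)) fun _ => by fun_prop
  have h1 := HasSubgaussianMGF.measure_sum_ge_le_of_iIndepFun hI1 (s := Finset.univ)
    (fun i _ => hsub i) ht
  have h2 := HasSubgaussianMGF.measure_sum_ge_le_of_iIndepFun hI2 (s := Finset.univ)
    (fun i _ => (hsub i).neg) ht
  have hc : 2 * ((∑ _i : ι, (‖(1 : ℝ) - 0‖₊ / 2) ^ 2 : NNReal) : ℝ) = Fintype.card ι / 2 := by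
    simp; ring
  rw [hc] at h1 h2
  calc _ ≤ μ.real ({ω | t ≤ ∑ i, ((A i).indicator (1 : Ω → ℝ) ω - q)} ∪
        {ω | t ≤ ∑ i, -((A i).indicator (1 : Ω → ℝ) ω - q)}) := by
        refine measureReal_mono ?_
        intro ω hω
        simp only [Set.mem_ofPred_eq, Set.mem_union, Finset.sum_neg_distrib, Finset.sum_sub_distrib,
          Finset.sum_const, Finset.card_univ, nsmul_eq_mul] at hω ⊢
        exact le_abs.1 hω
    _ ≤ _ := by
        refine (measureReal_union_le _ _).trans ?_
        linarith

end Probability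

/-! ### Joint neighbourhoods in the random graph -/

namespace SimpleGraph

open MeasureTheory ProbabilityTheory unitInterval

/-- The common neighbours of the vertices in `S`. -/
noncomputable def jointNbhd {V : Type*} [Fintype V] (G : SimpleGraph V) (S : Finset V) :
    Finset V := by
  classical exact Finset.univ.filter fun y => ∀ a ∈ S, G.Adj a y

theorem mem_jointNbhd {V : Type*} [Fintype V] {G : SimpleGraph V} {S : Finset V} {y : V} :
    y ∈ G.jointNbhd S ↔ ∀ a ∈ S, G.Adj a y := by
  simp [jointNbhd]

/-- Every set of at most `m` vertices has about as many common neighbours as expected in a random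
graph of density `p`. -/
def JointNbhdsRegular {V : Type*} [Fintype V] (G : SimpleGraph V) (p δ : ℝ) (m : ℕ) : Prop :=
  ∀ S : Finset V, S.card ≤ m → |((G.jointNbhd S).card : ℝ) - p ^ S.card * Fintype.card V| ≤
    δ * (p ^ S.card * Fintype.card V)

/-- The product measure on indicator functions of sets of pairs underlying `G(V, p)`. -/
noncomputable def edgeMeasure (V : Type*) (p : I) : Measure (Sym2 V → Prop) :=
  Measure.infinitePi fun e : Sym2 V =>
    toNNReal p • Measure.dirac (e ∈ (Sym2.diagSetᶜ : Set (Sym2 V))) +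
      toNNReal (σ p) • Measure.dirac False

instance {V : Type*} (p : I) : IsProbabilityMeasure (edgeMeasure V p) := by
  unfold edgeMeasure; infer_instance

/-- Moves events about the random graph to the product space of pairs, where independence can be
read off. -/
theorem binomialRandom_apply_eq_edgeMeasure {V : Type*} [Finite V] (p : I)
    (S : Set (SimpleGraph V)) :
    binomialRandom V p S = edgeMeasure V p {ω | fromEdgeSet {e | ω e} ∈ S} := by
  rw [binomialRandom_eq_map, setBernoulli_eq_map, Measure.map_map, Measure.map_apply]
  · rfl
  · exact measurable_fromEdgeSet.comp (by fun_prop)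
  · rw [← measurableEmbedding_edgeSet.measurableSet_image]
    exact (Set.toFinite _).measurableSet
  · exact measurable_fromEdgeSet
  · fun_prop

theorem edgeMeasure_forall_mem {V : Type*} (p : I) (s : Finset (Sym2 V))
    (hs : ∀ e ∈ s, ¬ e.IsDiag) :
    edgeMeasure V p {ω | ∀ e ∈ s, ω e} = (toNNReal p : ENNReal) ^ s.card := by
  have : {ω : Sym2 V → Prop | ∀ e ∈ s, ω e} = (s : Set (Sym2 V)).pi fun _ => {q : Prop | q} := by
    ext; simp [Set.pi]
  rw [this, edgeMeasure, Measure.infinitePi_pi _ (fun _ _ => .of_discrete),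
    Finset.prod_congr rfl, Finset.prod_const]
  intro e he
  simp [hs e he]

/-- The event that `y` is a common neighbour of `S`. -/
def allJoined {V : Type*} (S : Finset V) (y : V) : Set (Sym2 V → Prop) :=
  {ω | ∀ a ∈ S, ω s(a, y)}

/-- As `S` and `t` are disjoint, the pairs `s(a, y)` are distinct and off the diagonal, so the event
prescribes exactly `|S| * |t|` independent coordinates. -/
theorem edgeMeasure_biInter_allJoined {V : Type*} [DecidableEq V] (p : I) (S t : Finset V)
    (ht : Disjoint S t) :
    edgeMeasure V p (⋂ y ∈ t, allJoined S y) = (toNNReal p : ENNReal) ^ (S.card * t.card) := by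
  have h : (⋂ y ∈ t, allJoined S y) = {ω | ∀ e ∈ (S ×ˢ t).image (fun x => s(x.1, x.2)), ω e} := by
    ext ω
    simp only [allJoined, Set.mem_iInter, Set.mem_ofPred_eq, Finset.mem_image, Finset.mem_product,
      Prod.exists]
    constructor
    · rintro h e ⟨a, b, ⟨ha, hb⟩, rfl⟩
      exact h b hb a ha
    · exact fun h y hy a ha => h _ ⟨a, y, ⟨ha, hy⟩, rfl⟩
  rw [h, edgeMeasure_forall_mem, Finset.card_image_of_injOn, Finset.card_product]
  · rintro ⟨a, b⟩ hab ⟨c, d⟩ hcd h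
    simp only [Finset.coe_product, Set.mem_prod, Finset.mem_coe] at hab hcd
    simp only [Sym2.eq_iff] at h
    rcases h with ⟨rfl, rfl⟩ | ⟨rfl, rfl⟩
    · rfl
    · exact absurd hcd.2 (Finset.disjoint_left.1 ht hab.1)
  · intro e he
    simp only [Finset.mem_image, Finset.mem_product, Prod.exists] at he
    obtain ⟨a, b, ⟨ha, hb⟩, rfl⟩ := he
    rw [Sym2.mk_isDiag_iff]
    rintro rfl
    exact Finset.disjoint_left.1 ht ha hb

theorem edgeMeasure_allJoined {V : Type*} (p : I) (S : Finset V) (y : V) (hy : y ∉ S) :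
    edgeMeasure V p (allJoined S y) = (toNNReal p : ENNReal) ^ S.card := by
  classical
  have := edgeMeasure_biInter_allJoined p S {y} (by simpa using hy)
  simpa using this

/-- Different vertices outside `S` look at disjoint sets of pairs. Inside `S` this fails, which is
why the index type excludes `S`. -/
theorem iIndepSet_allJoined {V : Type*} [Finite V] (p : I) (S : Finset V) :
    iIndepSet (fun y : {y : V // y ∉ S} => allJoined S (y : V)) (edgeMeasure V p) := by
  classical
  rw [iIndepSet_iff_meas_biInter fun y => .of_discrete]
  intro t
  have := edgeMeasure_biInter_allJoined p S (t.map (Function.Embedding.subtype _))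
    (by rw [Finset.disjoint_right]; simp +contextual)
  simp only [Finset.card_map] at this
  have h2 : (⋂ y ∈ t.map (Function.Embedding.subtype _), allJoined S y) =
    ⋂ i ∈ t, allJoined S (i : V) := by
    ext; simp
  rw [← h2, this, Finset.prod_congr rfl fun (y : {y // y ∉ S}) _ =>
    edgeMeasure_allJoined p S (y : V) y.2, Finset.prod_const, pow_mul]

/-- Restricting to `y ∉ S` loses nothing: a vertex of `S` would have to be adjacent to itself. -/
theorem card_jointNbhd_eq_sum {V : Type*} [Fintype V] [DecidableEq V] (S : Finset V)
    (ω : Sym2 V → Prop) :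
    (((fromEdgeSet {e | ω e}).jointNbhd S).card : ℝ) =
      ∑ y : {y : V // y ∉ S}, (allJoined S (y : V)).indicator (1 : (Sym2 V → Prop) → ℝ) ω := by
  classical
  have h1 : (fromEdgeSet {e | ω e}).jointNbhd S =
      Finset.univ.filter fun y => y ∉ S ∧ ω ∈ allJoined S y := by
    ext y
    rw [mem_jointNbhd, Finset.mem_filter]
    simp only [fromEdgeSet_adj, allJoined, Finset.mem_univ, true_and, Set.mem_ofPred_eq]
    exact ⟨fun h => ⟨fun hy => (h y hy).2 rfl, fun a ha => (h a ha).1⟩,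
      fun h a ha => ⟨h.2 a ha, fun e => h.1 (e ▸ ha)⟩⟩
  rw [h1, ← Finset.filter_filter, Finset.card_filter, Nat.cast_sum,
    Finset.sum_subtype (p := fun y => y ∉ S) _ (by simp)]
  refine Finset.sum_congr rfl fun y _ => ?_
  by_cases h : ω ∈ allJoined S (y : V) <;> simp [h]

/-- Hoeffding centres the count at `p ^ |S| * (n - |S|)`; the extra `|S|` in the threshold pays for
recentring at `p ^ |S| * n`. -/
theorem edgeMeasure_not_regular_le {V : Type*} [Fintype V] (p : I) (S : Finset V)
    (hS : S.card < Fintype.card V) {t : ℝ} (ht : 0 ≤ t) :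
    (edgeMeasure V p).real {ω | t + S.card <
      |(((fromEdgeSet {e | ω e}).jointNbhd S).card : ℝ) - p ^ S.card * Fintype.card V|} ≤
      2 * Real.exp (-(2 * t ^ 2 / Fintype.card V)) := by
  classical
  have h := (iIndepSet_allJoined p S).measureReal_abs_sum_indicator_sub_le
    (fun _ => .of_discrete) (q := (p : ℝ) ^ S.card) (fun y => by
      rw [measureReal_def, edgeMeasure_allJoined p S y y.2]; simp) ht
  have hcard : (Fintype.card {y : V // y ∉ S} : ℝ) = Fintype.card V - S.card := by
    rw [Fintype.card_subtype_compl, Nat.cast_sub (by simpa using S.card_le_univ)]; simp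
  have hp0 : 0 ≤ (p : ℝ) ^ S.card := pow_nonneg p.2.1 _
  have hp1 : (p : ℝ) ^ S.card ≤ 1 := pow_le_one₀ p.2.1 p.2.2
  refine (measureReal_mono ?_).trans (h.trans ?_)
  · intro ω hω
    simp only [Set.mem_ofPred_eq, ← card_jointNbhd_eq_sum, hcard] at hω ⊢
    by_contra! hc
    have := abs_sub_le (((fromEdgeSet {e | ω e}).jointNbhd S).card : ℝ)
      ((Fintype.card V - S.card) * (p : ℝ) ^ S.card) (p ^ S.card * Fintype.card V)
    have h2 : |(Fintype.card V - S.card) * (p : ℝ) ^ S.card - p ^ S.card * Fintype.card V| ≤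
        S.card := by
      have : (Fintype.card V - S.card) * (p : ℝ) ^ S.card - p ^ S.card * Fintype.card V =
        -(S.card * (p : ℝ) ^ S.card) := by ring
      rw [this, abs_neg, abs_of_nonneg (by positivity)]
      exact mul_le_of_le_one_right (by positivity) hp1
    linarith
  · have h0 : (0 : ℝ) < Fintype.card V - S.card := sub_pos.2 (Nat.cast_lt.2 hS)
    rw [hcard, neg_div, div_div_eq_mul_div, mul_comm (t ^ 2)]
    gcongr
    simp

/-- For fixed `δ` and `m`, the random graph has regular joint neighbourhoods asymptotically almost
surely. -/
theorem asymptoticallyAlmostSurely_jointNbhdsRegular {p : I} (hp : 0 < p) {δ : ℝ} (hδ : 0 < δ)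
    (m : ℕ) : AsymptoticallyAlmostSurely p fun _ G => G.JointNbhdsRegular p δ m := by
  have hp' : (0 : ℝ) < p := hp
  -- Half of the allowed deviation `δ p ^ s n` is used as Hoeffding's `t = α n`, the other half
  -- absorbs `|S| ≤ m ≤ α n`.
  obtain ⟨α, hα, hαS⟩ : ∃ α : ℝ, 0 < α ∧ ∀ s ≤ m, 2 * α ≤ δ * (p : ℝ) ^ s := by
    refine ⟨δ * p ^ m / 2, by positivity, fun s hs => ?_⟩
    have : (p : ℝ) ^ m ≤ p ^ s := pow_le_pow_of_le_one hp'.le p.2.2 hs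
    have := mul_le_mul_of_nonneg_left this hδ.le
    linarith
  have hbad : ∀ᶠ n : ℕ in atTop, (binomialRandom (Fin n) p).real
      {G | ¬ G.JointNbhdsRegular p δ m} ≤
        (m + 1) * ((n : ℝ) ^ m * (2 * Real.exp (-(2 * α ^ 2 * n)))) := by
    have hev : ∀ᶠ n : ℕ in atTop, (m : ℝ) ≤ α * n :=
      (tendsto_natCast_atTop_atTop.const_mul_atTop hα).eventually_ge_atTop _
    filter_upwards [hev, eventually_gt_atTop m] with n hn hmn
    have hn0 : (0 : ℝ) < n := by exact_mod_cast (Nat.zero_le m).trans_lt hmn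
    let 𝒮 : Finset (Finset (Fin n)) :=
      (Finset.range (m + 1)).biUnion fun s => Finset.powersetCard s Finset.univ
    have h𝒮 : ∀ S, S ∈ 𝒮 ↔ S.card ≤ m := by
      intro S; simp [𝒮, Finset.mem_powersetCard]
    have hcard : (𝒮.card : ℝ) ≤ (m + 1) * (n : ℝ) ^ m := by
      have : 𝒮.card ≤ (m + 1) * n ^ m := by
        refine Finset.card_biUnion_le.trans ?_
        refine (Finset.sum_le_card_nsmul _ _ (n ^ m) fun s hs => ?_).trans (by simp)
        rw [Finset.card_powersetCard, Finset.card_univ, Fintype.card_fin]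
        exact (Nat.choose_le_pow n s).trans
          (Nat.pow_le_pow_right (by omega) (Nat.lt_succ_iff.1 (Finset.mem_range.1 hs)))
      exact_mod_cast this
    rw [measureReal_def, binomialRandom_apply_eq_edgeMeasure, ← measureReal_def]
    -- Union bound over the at most `(m + 1) n ^ m` sets of size at most `m`.
    calc _ ≤ (edgeMeasure (Fin n) p).real (⋃ S ∈ 𝒮, {ω | α * n + S.card <
          |(((fromEdgeSet {e | ω e}).jointNbhd S).card : ℝ) -
            p ^ S.card * Fintype.card (Fin n)|}) := by
          refine measureReal_mono ?_ (measure_ne_top _ _)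
          intro ω hω
          simp only [JointNbhdsRegular, Set.mem_ofPred_eq, not_forall, not_le] at hω
          obtain ⟨S, hS, hω⟩ := hω
          simp only [Set.mem_iUnion]
          refine ⟨S, (h𝒮 S).2 hS, lt_of_le_of_lt ?_ hω⟩
          have h1 : (S.card : ℝ) ≤ m := Nat.cast_le.2 hS
          have h2 := mul_le_mul_of_nonneg_right (hαS _ hS) hn0.le
          rw [Fintype.card_fin]
          linarith
      _ ≤ ∑ S ∈ 𝒮, 2 * Real.exp (-(2 * α ^ 2 * n)) := by
          refine (measureReal_biUnion_finset_le _ _).trans (Finset.sum_le_sum fun S hS => ?_)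
          refine (edgeMeasure_not_regular_le p S ?_ (by positivity)).trans_eq ?_
          · simpa using ((h𝒮 S).1 hS).trans_lt hmn
          · rw [Fintype.card_fin]
            congr 3
            field_simp
      _ ≤ _ := by
          rw [Finset.sum_const, nsmul_eq_mul, ← mul_assoc ((m : ℝ) + 1)]
          gcongr
  have hlim : Tendsto (fun n : ℕ => (m + 1) * ((n : ℝ) ^ m * (2 * Real.exp (-(2 * α ^ 2 * n)))))
      atTop (𝓝 0) := by
    have h1 := ((Real.tendsto_pow_mul_exp_neg_atTop_nhds_zero m).comp
      (tendsto_natCast_atTop_atTop.const_mul_atTop (r := 2 * α ^ 2) (by positivity))).const_mul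
        ((m + 1) * 2 / (2 * α ^ 2) ^ m)
    rw [mul_zero] at h1
    refine h1.congr fun n => ?_
    simp only [Function.comp, mul_pow (2 * α ^ 2) (n : ℝ)]
    field_simp
  have hreal : Tendsto (fun n : ℕ => (binomialRandom (Fin n) p).real
      {G | ¬ G.JointNbhdsRegular p δ m}) atTop (𝓝 0) :=
    squeeze_zero' (Eventually.of_forall fun _ => measureReal_nonneg) hbad hlim
  have h1 : ∀ n : ℕ, binomialRandom (Fin n) p {G | G.JointNbhdsRegular p δ m} =
      ENNReal.ofReal (1 - (binomialRandom (Fin n) p).real {G | ¬ G.JointNbhdsRegular p δ m}) := by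
    intro n
    have hmeas : MeasurableSet {G : SimpleGraph (Fin n) | G.JointNbhdsRegular p δ m} := by
      rw [← measurableEmbedding_edgeSet.measurableSet_image]
      exact (Set.toFinite _).measurableSet
    have := probReal_compl_eq_one_sub (μ := binomialRandom (Fin n) p) hmeas
    have hc : {G : SimpleGraph (Fin n) | ¬ G.JointNbhdsRegular p δ m} =
      {G : SimpleGraph (Fin n) | G.JointNbhdsRegular p δ m}ᶜ := rfl
    rw [hc, this, sub_sub_cancel, measureReal_def, ENNReal.ofReal_toReal (measure_ne_top _ _)]
  unfold AsymptoticallyAlmostSurely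
  simp only [h1]
  have := ENNReal.tendsto_ofReal (hreal.const_sub 1)
  simpa using this

end SimpleGraph

/-! ### Clique tuples and their marginals -/

namespace SimpleGraph

section CliqueTuples

open scoped Classical

variable {V ι : Type*} [Fintype V] [Fintype ι] {G : SimpleGraph V}

/-- The families of pairwise adjacent vertices of `G` indexed by `ι`. -/
noncomputable def cliqueTuples (G : SimpleGraph V) (ι : Type*) [Fintype ι] : Finset (ι → V) :=
  Finset.univ.filter fun x => ∀ i j, i ≠ j → G.Adj (x i) (x j)

theorem mem_cliqueTuples {x : ι → V} :
    x ∈ G.cliqueTuples ι ↔ ∀ i j, i ≠ j → G.Adj (x i) (x j) := by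
  simp [cliqueTuples]

theorem injective_of_mem_cliqueTuples {x : ι → V} (hx : x ∈ G.cliqueTuples ι) :
    Function.Injective x := fun i j h => by
  by_contra hij
  exact (mem_cliqueTuples.1 hx i j hij).ne h

/-- The typical number of extensions of a `t`-clique to an `m`-clique in a random graph with `n`
vertices and density `p`. -/
noncomputable def extensionWeight (p : ℝ) (n m t : ℕ) : ℝ := ∏ s ∈ Finset.Ico t m, p ^ s * n

theorem extensionWeight_eq_mul {p : ℝ} {n m t : ℕ} (h : t < m) :
    extensionWeight p n m t = p ^ t * n * extensionWeight p n m (t + 1) :=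
  (Finset.prod_eq_prod_Ico_succ_bot h _)

theorem extensionWeight_nonneg {p : ℝ} (hp : 0 ≤ p) (n m t : ℕ) : 0 ≤ extensionWeight p n m t :=
  Finset.prod_nonneg fun _ _ => by positivity

theorem extensionWeight_pos {p : ℝ} (hp : 0 < p) {n : ℕ} (hn : 0 < n) (m t : ℕ) :
    0 < extensionWeight p n m t :=
  Finset.prod_pos fun _ _ => by positivity

/-- Greedy extension: the vertex at a new index ranges over the joint neighbourhood of the vertices
already placed, whose size is known up to `1 ± δ`. Each of the `k` remaining indices contributes one
such factor. -/
theorem card_cliqueTuples_extending {p δ : ℝ} (hp : 0 ≤ p) (hδ0 : 0 ≤ δ) (hδ1 : δ ≤ 1)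
    (hG : G.JointNbhdsRegular p δ (Fintype.card ι)) (k : ℕ) :
    ∀ (S : Finset ι), S.card + k = Fintype.card ι → ∀ a : ι → V,
      (∀ i ∈ S, ∀ j ∈ S, i ≠ j → G.Adj (a i) (a j)) →
      (1 - δ) ^ k * extensionWeight p (Fintype.card V) (Fintype.card ι) S.card ≤
        (((G.cliqueTuples ι).filter fun x => ∀ i ∈ S, x i = a i).card : ℝ) ∧
      (((G.cliqueTuples ι).filter fun x => ∀ i ∈ S, x i = a i).card : ℝ) ≤
        (1 + δ) ^ k * extensionWeight p (Fintype.card V) (Fintype.card ι) S.card := by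
  induction k with
  | zero =>
    intro S hS a ha
    have hSu : S = Finset.univ := (Finset.card_eq_iff_eq_univ S).1 (by simpa using hS)
    subst hSu
    have : (G.cliqueTuples ι).filter (fun x => ∀ i ∈ Finset.univ, x i = a i) = {a} := by
      ext x
      simp only [Finset.mem_filter, Finset.mem_univ, true_imp_iff, Finset.mem_singleton]
      constructor
      · exact fun h => funext h.2
      · rintro rfl
        exact ⟨mem_cliqueTuples.2 fun i j => ha i (Finset.mem_univ _) j (Finset.mem_univ _),
          fun _ => rfl⟩
    rw [this]
    simp [extensionWeight]
  | succ k ih =>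
    intro S hS a ha
    obtain ⟨i, hi⟩ : ∃ i, i ∉ S := by
      by_contra! h
      rw [(Finset.eq_univ_iff_forall).2 h, Finset.card_univ] at hS
      omega
    have hsplit : ((G.cliqueTuples ι).filter fun x => ∀ i ∈ S, x i = a i).card =
        ∑ y ∈ G.jointNbhd (S.image a), ((G.cliqueTuples ι).filter fun x =>
          ∀ j ∈ insert i S, x j = Function.update a i y j).card := by
      rw [Finset.card_eq_sum_card_fiberwise (f := fun x => x i) (t := G.jointNbhd (S.image a))]
      · refine Finset.sum_congr rfl fun y _ => ?_
        rw [Finset.filter_filter]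
        congr 1
        ext x
        simp only [Finset.mem_filter, Finset.forall_mem_insert, Function.update_self]
        refine and_congr_right fun _ => ?_
        rw [and_comm]
        refine and_congr_right fun _ => forall₂_congr fun j hj => ?_
        rw [Function.update_of_ne (ne_of_mem_of_not_mem hj hi)]
      · intro x hx
        simp only [Finset.coe_filter, Set.mem_ofPred_eq] at hx
        rw [Finset.mem_coe, mem_jointNbhd]
        intro b hb
        obtain ⟨j, hj, rfl⟩ := Finset.mem_image.1 hb
        rw [← hx.2 j hj]
        exact mem_cliqueTuples.1 hx.1 j i (ne_of_mem_of_not_mem hj hi)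
    have hcardS : (S.image a).card = S.card := Finset.card_image_of_injOn fun j hj l hl h => by
      by_contra hjl
      exact (ha j hj l hl hjl).ne h
    have hcardi : (insert i S).card = S.card + 1 := Finset.card_insert_of_notMem hi
    have hext : ∀ y ∈ G.jointNbhd (S.image a), ∀ j ∈ insert i S, ∀ l ∈ insert i S, j ≠ l →
        G.Adj (Function.update a i y j) (Function.update a i y l) := by
      intro y hy j hj l hl hjl
      rw [mem_jointNbhd] at hy
      have hy' : ∀ l ∈ S, G.Adj (a l) y := fun l hl => hy _ (Finset.mem_image_of_mem _ hl)
      have hne : ∀ l ∈ S, l ≠ i := fun l hl e => hi (e ▸ hl)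
      rcases Finset.mem_insert.1 hj with hji | hj <;> rcases Finset.mem_insert.1 hl with hli | hl
      · exact absurd (hji.trans hli.symm) hjl
      · rw [hji, Function.update_self, Function.update_of_ne (hne l hl)]
        exact (hy' l hl).symm
      · rw [hli, Function.update_self, Function.update_of_ne (hne j hj)]
        exact hy' j hj
      · rw [Function.update_of_ne (hne l hl), Function.update_of_ne (hne j hj)]
        exact ha j hj l hl hjl
    have hN := abs_le.1 (hG (S.image a) (by rw [hcardS]; omega))
    rw [hcardS] at hN
    have hW : 0 ≤ extensionWeight p (Fintype.card V) (Fintype.card ι) (S.card + 1) :=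
      extensionWeight_nonneg hp _ _ _
    have hih := fun y hy => ih (insert i S) (by omega) (Function.update a i y) (hext y hy)
    rw [hcardi] at hih
    rw [extensionWeight_eq_mul (by omega), hsplit, Nat.cast_sum]
    constructor
    · refine le_trans ?_ (Finset.card_nsmul_le_sum _ _ _ fun y hy => (hih y hy).1)
      rw [nsmul_eq_mul, pow_succ']
      have : (1 - δ) * (p ^ S.card * Fintype.card V) ≤
        (G.jointNbhd (S.image a)).card := by linarith [hN.1]
      calc _ = ((1 - δ) * (p ^ S.card * Fintype.card V)) * ((1 - δ) ^ k *
            extensionWeight p (Fintype.card V) (Fintype.card ι) (S.card + 1)) := by ring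
        _ ≤ _ := mul_le_mul_of_nonneg_right this
            (mul_nonneg (pow_nonneg (by linarith) _) hW)
    · refine (Finset.sum_le_card_nsmul _ _ _ fun y hy => (hih y hy).2).trans ?_
      rw [nsmul_eq_mul, pow_succ']
      have : ((G.jointNbhd (S.image a)).card : ℝ) ≤
        (1 + δ) * (p ^ S.card * Fintype.card V) := by linarith [hN.2]
      calc _ ≤ ((1 + δ) * (p ^ S.card * Fintype.card V)) * ((1 + δ) ^ k *
            extensionWeight p (Fintype.card V) (Fintype.card ι) (S.card + 1)) :=
            mul_le_mul_of_nonneg_right this (mul_nonneg (pow_nonneg (by linarith) _) hW)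
        _ = _ := by ring

/-- Restricting a uniformly random clique tuple to `k` of its indices gives an almost uniformly
distributed clique tuple. -/
def HasRegularMarginals (G : SimpleGraph V) (ι : Type*) [Fintype ι] (p θ : ℝ) : Prop :=
  ∀ ⦃k : ℕ⦄ (τ : Fin k → ι), Function.Injective τ → ∀ g : (Fin k → V) → ℝ, (∀ y, 0 ≤ g y) →
    (∀ y, y ∉ G.cliqueTuples (Fin k) → g y = 0) →
    (1 - θ) * extensionWeight p (Fintype.card V) (Fintype.card ι) k * ∑ y, g y ≤
        ∑ x ∈ G.cliqueTuples ι, g (x ∘ τ) ∧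
      ∑ x ∈ G.cliqueTuples ι, g (x ∘ τ) ≤
        (1 + θ) * extensionWeight p (Fintype.card V) (Fintype.card ι) k * ∑ y, g y

/-- The sum is grouped by the restriction `x ∘ τ = y`; each fibre over a clique `y` counts
extensions of a partial clique. Fibres over non-cliques do not matter because `g` vanishes there. -/
theorem JointNbhdsRegular.hasRegularMarginals [Nonempty V] {p δ θ : ℝ} (hp : 0 ≤ p)
    (hδ0 : 0 ≤ δ) (hδ1 : δ ≤ 1) (hG : G.JointNbhdsRegular p δ (Fintype.card ι))
    (hθ0 : 1 - θ ≤ (1 - δ) ^ Fintype.card ι) (hθ1 : (1 + δ) ^ Fintype.card ι ≤ 1 + θ) :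
    G.HasRegularMarginals ι p θ := by
  intro k τ hτ g hg0 hg
  have hsum : ∑ x ∈ G.cliqueTuples ι, g (x ∘ τ) =
      ∑ y, (((G.cliqueTuples ι).filter fun x => x ∘ τ = y).card : ℝ) * g y := by
    rw [← Finset.sum_fiberwise (G.cliqueTuples ι) (fun x => x ∘ τ)]
    refine Finset.sum_congr rfl fun y _ => ?_
    rw [← nsmul_eq_mul, ← Finset.sum_const]
    refine Finset.sum_congr rfl fun x hx => ?_
    rw [(Finset.mem_filter.1 hx).2]
  have hcard : (Finset.univ.image τ).card = k := by
    rw [Finset.card_image_of_injective _ hτ, Finset.card_univ, Fintype.card_fin]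
  have hle : k ≤ Fintype.card ι := by
    simpa using Fintype.card_le_of_injective τ hτ
  have hW := extensionWeight_nonneg hp (Fintype.card V) (Fintype.card ι) (k)
  have key : ∀ y ∈ G.cliqueTuples (Fin k),
      (1 - θ) * extensionWeight p (Fintype.card V) (Fintype.card ι) (k) ≤
        (((G.cliqueTuples ι).filter fun x => x ∘ τ = y).card : ℝ) ∧
      (((G.cliqueTuples ι).filter fun x => x ∘ τ = y).card : ℝ) ≤
        (1 + θ) * extensionWeight p (Fintype.card V) (Fintype.card ι) (k) := by
    intro y hy
    -- The partial assignment only matters on the range of `τ`; elsewhere an arbitrary vertex serves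
    -- as filler.
    have h := card_cliqueTuples_extending hp hδ0 hδ1 hG (Fintype.card ι - k)
      (Finset.univ.image τ) (by omega) (Function.extend τ y fun _ => Classical.arbitrary V) (by
        simp only [Finset.mem_image, Finset.mem_univ, true_and]
        rintro _ ⟨i, rfl⟩ _ ⟨j, rfl⟩ hij
        rw [hτ.extend_apply, hτ.extend_apply]
        exact mem_cliqueTuples.1 hy i j fun e => hij (e ▸ rfl))
    have hf : ((G.cliqueTuples ι).filter fun x => ∀ i ∈ Finset.univ.image τ,
        x i = Function.extend τ y (fun _ => Classical.arbitrary V) i) =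
        (G.cliqueTuples ι).filter fun x => x ∘ τ = y := by
      refine Finset.filter_congr fun x _ => ?_
      simp [funext_iff, hτ.extend_apply]
    rw [hcard, hf] at h
    refine ⟨le_trans ?_ h.1, h.2.trans ?_⟩
    · gcongr
      exact hθ0.trans (pow_le_pow_of_le_one (by linarith) (by linarith) (Nat.sub_le _ _))
    · gcongr
      exact (pow_le_pow_right₀ (by linarith) (Nat.sub_le _ _)).trans hθ1
  rw [hsum, Finset.mul_sum, Finset.mul_sum]
  constructor <;> refine Finset.sum_le_sum fun y _ => ?_
  · by_cases hy : y ∈ G.cliqueTuples (Fin k)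
    · exact mul_le_mul_of_nonneg_right (key y hy).1 (hg0 y)
    · simp [hg y hy]
  · by_cases hy : y ∈ G.cliqueTuples (Fin k)
    · exact mul_le_mul_of_nonneg_right (key y hy).2 (hg0 y)
    · simp [hg y hy]

theorem sum_fin_succ_arrow {V : Type*} [Fintype V] {k : ℕ} (f : (Fin (k + 1) → V) → ℝ) :
    ∑ y, f y = ∑ a, ∑ z : Fin k → V, f (Fin.cons a z) := by
  rw [← Fintype.sum_prod_type']
  exact (Fintype.sum_equiv (Fin.consEquiv fun _ => V) _ _ fun _ => rfl).symm

namespace HasRegularMarginals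

variable {p θ : ℝ}

theorem card_cliqueTuples (h : G.HasRegularMarginals ι p θ) :
    ((G.cliqueTuples ι).card : ℝ) ≤
      (1 + θ) * extensionWeight p (Fintype.card V) (Fintype.card ι) 0 := by
  have := (h (k := 0) (fun i => i.elim0) (fun i => i.elim0) (fun _ => 1) (fun _ => zero_le_one)
    fun y hy => absurd (mem_cliqueTuples.2 fun i => i.elim0) hy).2
  simpa using this

theorem sum_one (h : G.HasRegularMarginals ι p θ) (i : ι) {g : V → ℝ} (hg : ∀ a, 0 ≤ g a) :
    (1 - θ) * extensionWeight p (Fintype.card V) (Fintype.card ι) 1 * ∑ a, g a ≤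
        ∑ x ∈ G.cliqueTuples ι, g (x i) ∧
      ∑ x ∈ G.cliqueTuples ι, g (x i) ≤
        (1 + θ) * extensionWeight p (Fintype.card V) (Fintype.card ι) 1 * ∑ a, g a := by
  have := h ![i] (Function.injective_of_subsingleton _) (fun y => g (y 0)) (fun _ => hg _)
    fun y hy => absurd (mem_cliqueTuples.2 fun i j hij => absurd (Subsingleton.elim i j) hij) hy
  rw [sum_fin_succ_arrow] at this
  simpa using this

theorem sum_two (h : G.HasRegularMarginals ι p θ) {i j : ι} (hij : i ≠ j) {g : V → V → ℝ}
    (hg0 : ∀ a b, 0 ≤ g a b) (hg : ∀ a b, ¬ G.Adj a b → g a b = 0) :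
    (1 - θ) * extensionWeight p (Fintype.card V) (Fintype.card ι) 2 * ∑ a, ∑ b, g a b ≤
        ∑ x ∈ G.cliqueTuples ι, g (x i) (x j) ∧
      ∑ x ∈ G.cliqueTuples ι, g (x i) (x j) ≤
        (1 + θ) * extensionWeight p (Fintype.card V) (Fintype.card ι) 2 * ∑ a, ∑ b, g a b := by
  have := h ![i, j] (by
      intro a b; fin_cases a <;> fin_cases b <;> simp [hij, hij.symm])
    (fun y => g (y 0) (y 1)) (fun _ => hg0 _ _) fun y hy => hg _ _ fun hadj => hy <| by
      rw [mem_cliqueTuples]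
      intro a b; fin_cases a <;> fin_cases b <;> simp [hadj, hadj.symm]
  simp only [sum_fin_succ_arrow] at this
  simpa using this

theorem sum_three (h : G.HasRegularMarginals ι p θ) {i j l : ι} (hij : i ≠ j) (hil : i ≠ l)
    (hjl : j ≠ l) {g : V → V → V → ℝ} (hg0 : ∀ a b c, 0 ≤ g a b c)
    (hg : ∀ a b c, ¬ (G.Adj a b ∧ G.Adj a c ∧ G.Adj b c) → g a b c = 0) :
    ∑ x ∈ G.cliqueTuples ι, g (x i) (x j) (x l) ≤
      (1 + θ) * extensionWeight p (Fintype.card V) (Fintype.card ι) 3 *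
        ∑ a, ∑ b, ∑ c, g a b c := by
  have := (h ![i, j, l] (by
      intro a b; fin_cases a <;> fin_cases b <;> simp [hij, hij.symm, hil, hil.symm, hjl, hjl.symm])
    (fun y => g (y 0) (y 1) (y 2)) (fun _ => hg0 _ _ _) fun y hy => hg _ _ _ fun hadj => hy <| by
      obtain ⟨h1, h2, h3⟩ := hadj
      rw [mem_cliqueTuples]
      intro a b; fin_cases a <;> fin_cases b <;> simp [h1, h2, h3, h1.symm, h2.symm, h3.symm]).2
  simp only [sum_fin_succ_arrow] at this
  have h2 : ∀ a b c : V, (Fin.cons a (Fin.cons b (Fin.cons c (default : Fin 0 → V))) :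
      Fin 3 → V) 2 = c := fun _ _ _ => rfl
  simpa [h2] using this

end HasRegularMarginals

end CliqueTuples

end SimpleGraph

/-! ### Second-moment estimates for edges and codegrees -/

namespace SimpleGraph

section Quasirandom

open scoped Classical

variable {V : Type*} {G : SimpleGraph V}

/-- The adjacency relation as a real-valued indicator. -/
noncomputable def adjInd (G : SimpleGraph V) (a b : V) : ℝ := if G.Adj a b then 1 else 0

theorem adjInd_of_adj {a b : V} (h : G.Adj a b) : G.adjInd a b = 1 := if_pos h

theorem adjInd_of_not_adj {a b : V} (h : ¬ G.Adj a b) : G.adjInd a b = 0 := if_neg h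

theorem adjInd_nonneg (a b : V) : 0 ≤ G.adjInd a b := by unfold adjInd; split_ifs <;> simp

theorem adjInd_le_one (a b : V) : G.adjInd a b ≤ 1 := by unfold adjInd; split_ifs <;> simp

theorem adjInd_mul_self (a b : V) : G.adjInd a b * G.adjInd a b = G.adjInd a b := by
  unfold adjInd; split_ifs <;> simp

variable [Fintype V] {p δ : ℝ} {m : ℕ}

theorem card_jointNbhd_eq_sum_prod (S : Finset V) :
    ((G.jointNbhd S).card : ℝ) = ∑ y, ∏ a ∈ S, G.adjInd a y := by
  have h : ∀ y, ∏ a ∈ S, G.adjInd a y = if y ∈ G.jointNbhd S then 1 else 0 := fun y => by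
    split_ifs with hy
    · exact Finset.prod_eq_one fun a ha => adjInd_of_adj (mem_jointNbhd.1 hy a ha)
    · simp only [mem_jointNbhd, not_forall] at hy
      obtain ⟨a, ha, h⟩ := hy
      exact Finset.prod_eq_zero ha (adjInd_of_not_adj h)
  simp [h]

namespace JointNbhdsRegular

theorem sum_prod_adjInd (hG : G.JointNbhdsRegular p δ m) {S : Finset V} (hS : S.card ≤ m) :
    (1 - δ) * (p ^ S.card * Fintype.card V) ≤ ∑ y, ∏ a ∈ S, G.adjInd a y ∧
      ∑ y, ∏ a ∈ S, G.adjInd a y ≤ (1 + δ) * (p ^ S.card * Fintype.card V) := by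
  have := abs_le.1 (hG S hS)
  rw [card_jointNbhd_eq_sum_prod] at this
  constructor <;> linarith [this.1, this.2]

theorem sum_adjInd (hG : G.JointNbhdsRegular p δ m) (hm : 3 ≤ m) (a : V) :
    (1 - δ) * (p * Fintype.card V) ≤ ∑ y, G.adjInd a y ∧
      ∑ y, G.adjInd a y ≤ (1 + δ) * (p * Fintype.card V) := by
  simpa using hG.sum_prod_adjInd (S := {a}) (by simp; omega)

theorem sum_adjInd_mul (hG : G.JointNbhdsRegular p δ m) (hm : 3 ≤ m) {a b : V} (hab : a ≠ b) :
    (1 - δ) * (p ^ 2 * Fintype.card V) ≤ ∑ y, G.adjInd a y * G.adjInd b y ∧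
      ∑ y, G.adjInd a y * G.adjInd b y ≤ (1 + δ) * (p ^ 2 * Fintype.card V) := by
  have h2 := Finset.card_pair hab
  have := hG.sum_prod_adjInd (S := {a, b}) (by omega)
  simpa [h2, Finset.prod_pair hab] using this

theorem sum_adjInd_mul_mul_le (hG : G.JointNbhdsRegular p δ m) (hm : 3 ≤ m) {a b c : V}
    (hab : a ≠ b) (hac : a ≠ c) (hbc : b ≠ c) :
    ∑ y, G.adjInd a y * (G.adjInd b y * G.adjInd c y) ≤ (1 + δ) * (p ^ 3 * Fintype.card V) := by
  have h2 : ({a, b, c} : Finset V).card = 3 := by simp [hab, hac, hbc]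
  have := (hG.sum_prod_adjInd (S := {a, b, c}) (by omega)).2
  simpa [h2, Finset.prod_insert, hab, hac, hbc] using this

/-- An upper bound for the number of edges inside a set. -/
theorem sum_sum_adjInd_le (hG : G.JointNbhdsRegular p δ m) (hm : 3 ≤ m) (hp0 : 0 ≤ p)
    (hp1 : p ≤ 1) (hδ : 0 ≤ δ) {β : ℝ} (hβ : 0 < β)
    (hn : 3 * δ * Fintype.card V + 1 ≤ 4 * β ^ 2 * Fintype.card V) (A : Finset V) :
    ∑ a ∈ A, ∑ b ∈ A, G.adjInd a b ≤ p * A.card ^ 2 + 2 * β * Fintype.card V ^ 2 := by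
  set n : ℝ := (Fintype.card V : ℝ) with hndef
  have hn0 : 0 < n := by
    rcases (Nat.cast_nonneg (α := ℝ) (Fintype.card V)).eq_or_lt with h | h
    · rw [hndef, ← h] at hn; norm_num at hn
    · exact h
  set F : ℝ := (A.card : ℝ) with hF
  have hFn : F ≤ n := Nat.cast_le.2 A.card_le_univ
  have hF0 : 0 ≤ F := Nat.cast_nonneg _
  set d : V → ℝ := fun b => ∑ a ∈ A, G.adjInd a b with hd
  have hsq : ∑ b, d b ^ 2 ≤ (1 + δ) * (p ^ 2 * n) * F ^ 2 + n * F := by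
    calc ∑ b, d b ^ 2 = ∑ a ∈ A, ∑ a' ∈ A, ∑ b, G.adjInd a b * G.adjInd a' b := by
          simp only [hd, sq, Finset.sum_mul_sum]
          rw [Finset.sum_comm]
          exact Finset.sum_congr rfl fun a _ => Finset.sum_comm
      _ ≤ ∑ a ∈ A, ∑ a' ∈ A, ((1 + δ) * (p ^ 2 * n) + if a = a' then n else 0) := by
          refine Finset.sum_le_sum fun a _ => Finset.sum_le_sum fun a' _ => ?_
          by_cases h : a = a'
          · subst h
            rw [if_pos rfl]
            have : ∑ b, G.adjInd a b * G.adjInd a b ≤ n := by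
              simp only [adjInd_mul_self]
              refine (Finset.sum_le_sum fun b _ => adjInd_le_one a b).trans_eq ?_
              simp [hndef]
            have h0 : 0 ≤ (1 + δ) * (p ^ 2 * n) := by positivity
            linarith
          · rw [if_neg h, add_zero]
            exact (hG.sum_adjInd_mul hm h).2
      _ = _ := by
          simp only [Finset.sum_add_distrib, Finset.sum_const, nsmul_eq_mul, Finset.sum_ite_eq,
            Finset.sum_ite_mem, Finset.inter_self, ← hF]
          ring
  have hlin : (1 - δ) * (p * n) * F ≤ ∑ b, d b := by
    simp only [hd]
    rw [Finset.sum_comm]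
    refine le_trans (le_of_eq ?_) (Finset.card_nsmul_le_sum _ _ _ fun a _ =>
      (hG.sum_adjInd hm a).1)
    rw [nsmul_eq_mul, mul_comm]
  -- The degrees `d b` into `A` have small variance about `p |A|`: pairs of vertices of `A`
  -- contribute codegrees close to `p ^ 2 n`, so the main terms cancel and leave `3 δ` and the
  -- diagonal.
  have hvar : ∑ b, (d b - p * F) ^ 2 ≤ 4 * β ^ 2 * n ^ 3 := by
    have : ∑ b, (d b - p * F) ^ 2 = ∑ b, d b ^ 2 - 2 * (p * F) * ∑ b, d b + n * (p * F) ^ 2 := by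
      simp only [sub_sq, Finset.sum_add_distrib, Finset.sum_sub_distrib, Finset.mul_sum,
        Finset.sum_const, nsmul_eq_mul, Finset.card_univ, ← hndef]
      congr 2
      exact Finset.sum_congr rfl fun b _ => by ring
    rw [this]
    have h1 := mul_le_mul_of_nonneg_left hlin (show 0 ≤ 2 * (p * F) by positivity)
    have h2 : 3 * δ * n * (p ^ 2 * F ^ 2) ≤ 3 * δ * n * n ^ 2 := by
      have : p ^ 2 * F ^ 2 ≤ 1 * n ^ 2 := by gcongr; exact pow_le_one₀ hp0 hp1
      exact mul_le_mul_of_nonneg_left (by linarith) (by positivity)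
    have h3 : n * F ≤ n ^ 2 := by nlinarith
    have h4 := mul_le_mul_of_nonneg_left hn (sq_nonneg n)
    nlinarith
  have hmain : ∑ b ∈ A, (d b - p * F) ≤ 2 * β * n ^ 2 := by
    have hpt : ∀ b, 4 * β * n * (d b - p * F) ≤ 4 * β ^ 2 * n ^ 2 + (d b - p * F) ^ 2 := fun b => by
      nlinarith [sq_nonneg (d b - p * F - 2 * β * n)]
    have h1 : 4 * β * n * ∑ b ∈ A, (d b - p * F) ≤ 4 * β ^ 2 * n ^ 3 + 4 * β ^ 2 * n ^ 3 := by
      calc _ ≤ ∑ b ∈ A, (4 * β ^ 2 * n ^ 2 + (d b - p * F) ^ 2) := by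
            rw [Finset.mul_sum]; exact Finset.sum_le_sum fun b _ => hpt b
        _ ≤ ∑ b, (4 * β ^ 2 * n ^ 2 + (d b - p * F) ^ 2) :=
            Finset.sum_le_sum_of_subset_of_nonneg (Finset.subset_univ _) fun b _ _ => by positivity
        _ ≤ _ := by
            rw [Finset.sum_add_distrib, Finset.sum_const, nsmul_eq_mul, Finset.card_univ, ← hndef]
            refine add_le_add (le_of_eq (by ring)) hvar
    have h2 : 0 < 4 * β * n := by positivity
    refine le_of_mul_le_mul_left (h1.trans_eq ?_) h2
    ring
  have : ∑ a ∈ A, ∑ b ∈ A, G.adjInd a b = ∑ b ∈ A, (d b - p * F) + p * F ^ 2 := by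
    rw [Finset.sum_comm, Finset.sum_sub_distrib, Finset.sum_const, nsmul_eq_mul, ← hF]
    ring
  rw [this]
  linarith

/-- The number of vertices of `B` adjacent to both `a` and `b`. -/
noncomputable def _root_.SimpleGraph.codegIn (G : SimpleGraph V) (B : Finset V) (a b : V) : ℝ :=
  ∑ v ∈ B, G.adjInd v a * G.adjInd v b

/-- The double sum counts ordered edges inside the neighbourhood of `v`: about `p n` choices of `a`,
then about `p ^ 2 n` common neighbours of `a` and `v`. -/
theorem sum_adjInd_mul_codeg (hG : G.JointNbhdsRegular p δ m) (hm : 3 ≤ m)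
    (hδ : 0 ≤ δ) (hδ1 : δ ≤ 1) (v : V) :
    (1 - δ) ^ 2 * (p ^ 3 * Fintype.card V ^ 2) ≤
      ∑ a, G.adjInd v a * ∑ b, G.adjInd a b * G.adjInd v b ∧
    ∑ a, G.adjInd v a * ∑ b, G.adjInd a b * G.adjInd v b ≤
      (1 + δ) ^ 2 * (p ^ 3 * Fintype.card V ^ 2) := by
  set n : ℝ := (Fintype.card V : ℝ) with hndef
  have hn0 : 0 ≤ n := Nat.cast_nonneg _
  have hne : ∀ a, G.Adj v a → a ≠ v := fun a h => h.ne'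
  constructor
  · calc _ = (1 - δ) * (p * n) * ((1 - δ) * (p ^ 2 * n)) := by ring
      _ ≤ (∑ a, G.adjInd v a) * ((1 - δ) * (p ^ 2 * n)) :=
          mul_le_mul_of_nonneg_right (hG.sum_adjInd hm v).1
            (mul_nonneg (by linarith) (by positivity))
      _ ≤ _ := by
          rw [Finset.sum_mul]
          refine Finset.sum_le_sum fun a _ => ?_
          by_cases h : G.Adj v a
          · exact mul_le_mul_of_nonneg_left (hG.sum_adjInd_mul hm (hne a h)).1 (adjInd_nonneg _ _)
          · simp [adjInd_of_not_adj h]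
  · calc _ ≤ (∑ a, G.adjInd v a) * ((1 + δ) * (p ^ 2 * n)) := by
          rw [Finset.sum_mul]
          refine Finset.sum_le_sum fun a _ => ?_
          by_cases h : G.Adj v a
          · exact mul_le_mul_of_nonneg_left (hG.sum_adjInd_mul hm (hne a h)).2 (adjInd_nonneg _ _)
          · simp [adjInd_of_not_adj h]
      _ ≤ (1 + δ) * (p * n) * ((1 + δ) * (p ^ 2 * n)) :=
          mul_le_mul_of_nonneg_right (hG.sum_adjInd hm v).2 (by positivity)
      _ = _ := by ring

/-- Ordered edges inside the common neighbourhood of `v` and `w`: about `p ^ 2 n` choices of `a`,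
then about `p ^ 3 n` choices of `b`. -/
theorem sum_adjInd_mul_mul_codeg_le (hG : G.JointNbhdsRegular p δ m) (hm : 3 ≤ m) (hp0 : 0 ≤ p)
    (hδ : 0 ≤ δ) {v w : V} (hvw : v ≠ w) :
    ∑ a, G.adjInd v a * G.adjInd w a * ∑ b, G.adjInd a b * (G.adjInd v b * G.adjInd w b) ≤
      (1 + δ) ^ 2 * (p ^ 5 * Fintype.card V ^ 2) := by
  set n : ℝ := (Fintype.card V : ℝ) with hndef
  have hn0 : 0 ≤ n := Nat.cast_nonneg _
  calc _ ≤ (∑ a, G.adjInd v a * G.adjInd w a) * ((1 + δ) * (p ^ 3 * n)) := by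
        rw [Finset.sum_mul]
        refine Finset.sum_le_sum fun a _ => ?_
        by_cases h : G.Adj v a
        · by_cases h' : G.Adj w a
          · exact mul_le_mul_of_nonneg_left (hG.sum_adjInd_mul_mul_le hm h.ne' h'.ne' hvw)
              (mul_nonneg (adjInd_nonneg _ _) (adjInd_nonneg _ _))
          · simp [adjInd_of_not_adj h']
        · simp [adjInd_of_not_adj h]
    _ ≤ (1 + δ) * (p ^ 2 * n) * ((1 + δ) * (p ^ 3 * n)) :=
        mul_le_mul_of_nonneg_right (hG.sum_adjInd_mul hm hvw).2 (by positivity)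
    _ = _ := by ring

/-- The codegree into `B` is concentrated on the edges of `G`. -/
theorem sum_adjInd_mul_codegIn_sub_sq_le (hG : G.JointNbhdsRegular p δ m) (hm : 3 ≤ m)
    (hp0 : 0 ≤ p) (hδ : 0 ≤ δ) (hδ1 : δ ≤ 1 / 3) (B : Finset V)
    (hB : 7 * δ * (B.card * p ^ 2) ≤ 1) :
    ∑ a, ∑ b, G.adjInd a b * (G.codegIn B a b - B.card * p ^ 2) ^ 2 ≤
      3 * (B.card * p ^ 3 * Fintype.card V ^ 2) := by
  set n : ℝ := (Fintype.card V : ℝ) with hndef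
  have hn0 : 0 ≤ n := Nat.cast_nonneg _
  set k : ℝ := (B.card : ℝ) with hk
  have hk0 : 0 ≤ k := Nat.cast_nonneg _
  have h2 : ∑ a, ∑ b, G.adjInd a b * G.codegIn B a b ^ 2 ≤
      k ^ 2 * ((1 + δ) ^ 2 * (p ^ 5 * n ^ 2)) + k * ((1 + δ) ^ 2 * (p ^ 3 * n ^ 2)) := by
    calc ∑ a, ∑ b, G.adjInd a b * G.codegIn B a b ^ 2 = ∑ v ∈ B, ∑ w ∈ B, ∑ a,
          G.adjInd v a * G.adjInd w a * ∑ b, G.adjInd a b * (G.adjInd v b * G.adjInd w b) := by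
          simp only [codegIn, sq, Finset.sum_mul_sum]
          simp only [Finset.mul_sum]
          simp only [Finset.sum_comm (s := B) (t := Finset.univ)]
          refine Finset.sum_congr rfl fun a _ => Finset.sum_congr rfl fun b _ =>
            Finset.sum_congr rfl fun v _ => Finset.sum_congr rfl fun w _ => by ring
      _ ≤ ∑ v ∈ B, ∑ w ∈ B, ((1 + δ) ^ 2 * (p ^ 5 * n ^ 2) +
            if v = w then (1 + δ) ^ 2 * (p ^ 3 * n ^ 2) else 0) := by
          refine Finset.sum_le_sum fun v _ => Finset.sum_le_sum fun w _ => ?_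
          by_cases h : v = w
          · subst h
            simp only [adjInd_mul_self, if_true]
            have := (hG.sum_adjInd_mul_codeg hm hδ (by linarith) v).2
            have h0 : 0 ≤ (1 + δ) ^ 2 * (p ^ 5 * n ^ 2) := by positivity
            linarith
          · rw [if_neg h, add_zero]
            exact hG.sum_adjInd_mul_mul_codeg_le hm hp0 hδ h
      _ = _ := by
          simp only [Finset.sum_add_distrib, Finset.sum_const, nsmul_eq_mul, Finset.sum_ite_eq,
            Finset.sum_ite_mem, Finset.inter_self, ← hk]
          ring
  have h1 : k * ((1 - δ) ^ 2 * (p ^ 3 * n ^ 2)) ≤ ∑ a, ∑ b, G.adjInd a b * G.codegIn B a b := by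
    calc _ ≤ ∑ v ∈ B, ∑ a, G.adjInd v a * ∑ b, G.adjInd a b * G.adjInd v b := by
          refine le_trans (le_of_eq ?_) (Finset.card_nsmul_le_sum _ _ _ fun v _ =>
            (hG.sum_adjInd_mul_codeg hm hδ (by linarith) v).1)
          rw [nsmul_eq_mul]
      _ = _ := by
          simp only [codegIn, Finset.mul_sum]
          simp only [Finset.sum_comm (s := B) (t := Finset.univ)]
          refine Finset.sum_congr rfl fun a _ => Finset.sum_congr rfl fun b _ =>
            Finset.sum_congr rfl fun v _ => by ring
  have h0 : ∑ a, ∑ b, G.adjInd a b ≤ (1 + δ) * (p * n ^ 2) := by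
    refine (Finset.sum_le_card_nsmul _ _ _ fun a _ => (hG.sum_adjInd hm a).2).trans_eq ?_
    rw [nsmul_eq_mul, Finset.card_univ, ← hndef]
    ring
  have hexp : ∑ a, ∑ b, G.adjInd a b * (G.codegIn B a b - k * p ^ 2) ^ 2 =
      ∑ a, ∑ b, G.adjInd a b * G.codegIn B a b ^ 2 -
        2 * (k * p ^ 2) * ∑ a, ∑ b, G.adjInd a b * G.codegIn B a b +
          (k * p ^ 2) ^ 2 * ∑ a, ∑ b, G.adjInd a b := by
    simp only [Finset.mul_sum, ← Finset.sum_add_distrib, ← Finset.sum_sub_distrib]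
    refine Finset.sum_congr rfl fun a _ => Finset.sum_congr rfl fun b _ => by ring
  -- The main terms of the expanded square cancel, since `(1 + δ)² - 2 (1 - δ)² + (1 + δ) = 7 δ -
  -- δ²`. By `hB` this remainder is at most one unit of `|B| p ^ 3 n ^ 2`, and the diagonal `v = w`
  -- gives at most two more.
  rw [hexp]
  have e1 := mul_le_mul_of_nonneg_left h1 (show 0 ≤ 2 * (k * p ^ 2) by positivity)
  have e0 := mul_le_mul_of_nonneg_left h0 (show 0 ≤ (k * p ^ 2) ^ 2 by positivity)
  have e3 := mul_le_mul_of_nonneg_right hB (show 0 ≤ k * p ^ 3 * n ^ 2 by positivity)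
  have e4 : (1 + δ) ^ 2 * (k * p ^ 3 * n ^ 2) ≤ 2 * (k * p ^ 3 * n ^ 2) :=
    mul_le_mul_of_nonneg_right (by nlinarith) (by positivity)
  have e5 : 0 ≤ δ ^ 2 * (k ^ 2 * p ^ 5 * n ^ 2) := by positivity
  nlinarith

/-- Codegrees into `B` summed over a subgraph of `G` are at most about what a typical
codegree gives. -/
theorem sum_sum_codegIn_le (hG : G.JointNbhdsRegular p δ m) (hm : 3 ≤ m)
    (hp0 : 0 < p) (hδ : 0 ≤ δ) (hδ1 : δ ≤ 1 / 3) {B : Finset V} (hB0 : B.Nonempty)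
    (hB : 7 * δ * (B.card * p ^ 2) ≤ 1) {τ ρ : ℝ} (hτ : 0 < τ) {R : V → Finset V}
    (hR : ∀ a, ∀ b ∈ R a, G.Adj a b) (hρ : ∀ a, ((R a).card : ℝ) ≤ ρ * (p * Fintype.card V)) :
    ∑ a, ∑ b ∈ R a, G.codegIn B a b ≤ B.card * p ^ 3 * Fintype.card V ^ 2 *
      ((1 + τ) * ρ + 3 / (4 * τ * (B.card * p ^ 2))) := by
  set n : ℝ := (Fintype.card V : ℝ) with hndef
  have hn0 : 0 ≤ n := Nat.cast_nonneg _
  have hk0 : (0 : ℝ) < B.card := Nat.cast_pos.2 hB0.card_pos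
  set k : ℝ := (B.card : ℝ) with hk
  have hK : 0 < k * p ^ 2 := by positivity
  -- With `K = |B| p ^ 2`, this is `X - K ≤ τ K + (X - K)² / (4 τ K)`, which makes the excess
  -- codegree payable by the variance.
  have hpt : ∀ a b, G.codegIn B a b ≤ (1 + τ) * (k * p ^ 2) +
      1 / (4 * τ * (k * p ^ 2)) * (G.codegIn B a b - k * p ^ 2) ^ 2 := by
    intro a b
    have h4 : 0 < 4 * τ * (k * p ^ 2) := by positivity
    rw [← sub_le_iff_le_add', one_div, inv_mul_eq_div, le_div_iff₀ h4]
    nlinarith [sq_nonneg (G.codegIn B a b - k * p ^ 2 - 2 * τ * (k * p ^ 2))]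
  calc ∑ a, ∑ b ∈ R a, G.codegIn B a b ≤ ∑ a, ∑ b ∈ R a, ((1 + τ) * (k * p ^ 2) +
        1 / (4 * τ * (k * p ^ 2)) * (G.adjInd a b * (G.codegIn B a b - k * p ^ 2) ^ 2)) := by
        refine Finset.sum_le_sum fun a _ => Finset.sum_le_sum fun b hb => ?_
        rw [adjInd_of_adj (hR a b hb), one_mul]
        exact hpt a b
    _ = (1 + τ) * (k * p ^ 2) * ∑ a, ((R a).card : ℝ) + 1 / (4 * τ * (k * p ^ 2)) *
        ∑ a, ∑ b ∈ R a, G.adjInd a b * (G.codegIn B a b - k * p ^ 2) ^ 2 := by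
        simp only [Finset.sum_add_distrib, Finset.sum_const, nsmul_eq_mul, Finset.mul_sum]
        congr 1
        exact Finset.sum_congr rfl fun a _ => mul_comm _ _
    _ ≤ (1 + τ) * (k * p ^ 2) * (n * (ρ * (p * n))) + 1 / (4 * τ * (k * p ^ 2)) *
        (3 * (k * p ^ 3 * n ^ 2)) := by
        gcongr
        · refine (Finset.sum_le_card_nsmul _ _ _ fun a _ => hρ a).trans_eq ?_
          rw [nsmul_eq_mul, Finset.card_univ]
        · refine le_trans (Finset.sum_le_sum fun a _ =>
            Finset.sum_le_sum_of_subset_of_nonneg (Finset.subset_univ _) fun b _ _ => ?_)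
            (hG.sum_adjInd_mul_codegIn_sub_sq_le hm hp0.le hδ hδ1 B hB)
          exact mul_nonneg (adjInd_nonneg _ _) (sq_nonneg _)
    _ = _ := by
        field_simp

end JointNbhdsRegular

end Quasirandom

end SimpleGraph

/-! ### Deleted degrees inside a random clique -/

namespace SimpleGraph

section Averaging

open scoped Classical

variable {V ι : Type*} [Fintype V] [Fintype ι] {G : SimpleGraph V} {p θ : ℝ}

theorem extensionWeight_recursions {m n : ℕ} (hm : 3 ≤ m) :
    extensionWeight p n m 1 = p * n * extensionWeight p n m 2 ∧
    extensionWeight p n m 2 = p ^ 2 * n * extensionWeight p n m 3 ∧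
    extensionWeight p n m 0 = n * extensionWeight p n m 1 := by
  refine ⟨?_, ?_, ?_⟩
  · rw [extensionWeight_eq_mul (by omega)]; simp
  · rw [extensionWeight_eq_mul (by omega)]
  · rw [extensionWeight_eq_mul (by omega)]; simp

/-- The first `t` factors `p ^ j * n` of the product are each at least `p ^ t * n`. -/
theorem pow_mul_extensionWeight_le {m n t : ℕ} (hp0 : 0 ≤ p) (hp1 : p ≤ 1) (ht : t ≤ m) :
    p ^ (t * t) * (n : ℝ) ^ t * extensionWeight p n m t ≤ extensionWeight p n m 0 := by
  have key : ∀ j ≤ t, (p ^ t * n) ^ j * extensionWeight p n m j ≤ extensionWeight p n m 0 := by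
    intro j
    induction j with
    | zero => simp
    | succ j ih =>
      intro hj
      refine le_trans ?_ (ih (by omega))
      rw [extensionWeight_eq_mul (t := j) (by omega), pow_succ, mul_assoc]
      have hW := extensionWeight_nonneg hp0 n m (j + 1)
      have : p ^ t ≤ p ^ j := pow_le_pow_of_le_one hp0 hp1 (by omega)
      gcongr
  simpa [mul_pow, ← pow_mul] using key t le_rfl

/-- The algebra behind the variance estimate in `HasRegularMarginals.card_filter_large_le`. -/
theorem variance_bound_aux {n m p θ β P Q W3 S0 S1 S2 : ℝ} (hn : 0 < n) (hm : 3 ≤ m)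
    (hp : 0 < p) (hθ0 : 0 ≤ θ) (hθ1 : θ ≤ 1) (hβ : 0 ≤ β) (hW : 0 ≤ W3) (hPn : P ≤ n)
    (hQn : Q ≤ n)
    (h2 : S2 ≤ m ^ 2 * ((1 + θ) * W3 * (p ^ 3 * n ^ 2 * Q + 2 * β * n ^ 3)) +
        m * ((1 + θ) * (p ^ 2 * n * W3) * (p * n * P)))
    (h1 : (m - 1) * ((1 - θ) * (p ^ 2 * n * W3) * (p * n * Q)) ≤ S1)
    (h0 : S0 ≤ (1 + θ) * (p * n * (p ^ 2 * n * W3)) * Q) :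
    S2 - 2 * m * S1 + m ^ 2 * S0 ≤ m ^ 2 * ((4 * θ + 4 / m + 4 * β / p ^ 3) *
      (n * (p * n * (p ^ 2 * n * W3)))) := by
  have e1 := mul_le_mul_of_nonneg_left h1 (show 0 ≤ 2 * m by positivity)
  have e0 := mul_le_mul_of_nonneg_left h0 (show 0 ≤ m ^ 2 by positivity)
  have hω : 0 ≤ p ^ 3 * n ^ 2 * W3 := by positivity
  have hrhs : m ^ 2 * ((4 * θ + 4 / m + 4 * β / p ^ 3) * (n * (p * n * (p ^ 2 * n * W3)))) =
      p ^ 3 * n ^ 2 * W3 * (n * (4 * θ * m ^ 2 + 4 * m)) + 4 * β * m ^ 2 * n ^ 3 * W3 := by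
    field_simp
  have hcore : m ^ 2 * (1 + θ) * Q + m * (1 + θ) * P - 2 * m * (m - 1) * (1 - θ) * Q +
      m ^ 2 * (1 + θ) * Q ≤ n * (4 * θ * m ^ 2 + 4 * m) := by
    have f1 : θ * m ^ 2 * Q ≤ θ * m ^ 2 * n := by gcongr
    have f2 : m * (1 - θ) * Q ≤ m * (1 - θ) * n :=
      mul_le_mul_of_nonneg_left hQn (mul_nonneg (by positivity) (by linarith))
    have f3 : m * (1 + θ) * P ≤ m * (1 + θ) * n := by gcongr
    have f4 : 0 ≤ m * θ * n := by positivity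
    have f5 : 0 ≤ m * n := by positivity
    nlinarith
  have hcore' := mul_le_mul_of_nonneg_left hcore hω
  have hβ' : (1 + θ) * (2 * β * m ^ 2 * n ^ 3 * W3) ≤ 2 * (2 * β * m ^ 2 * n ^ 3 * W3) :=
    mul_le_mul_of_nonneg_right (by linarith) (by positivity)
  rw [hrhs]
  linarith

/-- Chebyshev. Given `x i = a`, the number of other entries in `R a` should be about `c a * m` with
`c a = |R a| / (p n)`, at most `ρ m`. The second moment needs only an upper bound for the edges
inside `R a`, which is `hE`; the mixed term and the square of the expected value come from two-point
and one-point marginals. -/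
theorem HasRegularMarginals.card_filter_large_le (h : G.HasRegularMarginals ι p θ)
    (hm : 3 ≤ Fintype.card ι) (hp0 : 0 < p) (hθ0 : 0 ≤ θ) (hθ1 : θ ≤ 1) {β : ℝ} (hβ : 0 ≤ β)
    {R : V → Finset V} (hR : ∀ a, ∀ b ∈ R a, G.Adj a b) {ρ : ℝ} (hρ1 : ρ ≤ 1)
    (hρ : ∀ a, ((R a).card : ℝ) ≤ ρ * (p * Fintype.card V))
    (hE : ∀ a, ∑ b ∈ R a, ∑ c ∈ R a, G.adjInd b c ≤
      p * (R a).card ^ 2 + 2 * β * Fintype.card V ^ 2)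
    (hn : 0 < Fintype.card V) {γ : ℝ} (hγ : 0 < γ) (i : ι) :
    γ ^ 2 * (((G.cliqueTuples ι).filter fun x => (ρ + γ) * Fintype.card ι <
      ((Finset.univ.filter fun j => x j ∈ R (x i)).card : ℝ)).card : ℝ) ≤
    (4 * θ + 4 / Fintype.card ι + 4 * β / p ^ 3) *
      extensionWeight p (Fintype.card V) (Fintype.card ι) 0 := by
  obtain ⟨hW1, hW2, hW0⟩ := extensionWeight_recursions (p := p) (n := Fintype.card V) hm
  set W0 := extensionWeight p (Fintype.card V) (Fintype.card ι) 0
  set W1 := extensionWeight p (Fintype.card V) (Fintype.card ι) 1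
  set W2 := extensionWeight p (Fintype.card V) (Fintype.card ι) 2
  set W3 := extensionWeight p (Fintype.card V) (Fintype.card ι) 3
  have hW3 : 0 ≤ W3 := extensionWeight_nonneg hp0.le _ _ _
  set m : ℝ := (Fintype.card ι : ℝ) with hmdef
  set n : ℝ := (Fintype.card V : ℝ) with hndef
  have hn0 : 0 < n := Nat.cast_pos.2 hn
  have hm3 : 3 ≤ m := by rw [hmdef]; exact_mod_cast hm
  clear_value n m
  have hW2n : 0 ≤ W2 := by rw [hW2]; positivity
  set r : V → V → ℝ := fun a b => if b ∈ R a then 1 else 0 with hr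
  have hr0 : ∀ a b, 0 ≤ r a b := fun a b => by simp only [hr]; split_ifs <;> simp
  have hrr : ∀ a b, r a b * r a b = r a b := fun a b => by simp only [hr]; split_ifs <;> simp
  have hradj : ∀ a b, ¬ G.Adj a b → r a b = 0 := fun a b hab => if_neg fun hb => hab (hR a b hb)
  have hrsum : ∀ a, ∑ b, r a b = (R a).card := fun a => by simp [hr]
  have hrmul : ∀ a (f : V → ℝ), ∑ b ∈ R a, f b = ∑ b, r a b * f b := fun a f => by simp [hr]
  set c : V → ℝ := fun a => (R a).card / (p * n) with hc
  have hpn : 0 < p * n := by positivity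
  have hcR : ∀ a, ((R a).card : ℝ) = c a * (p * n) := fun a => (div_mul_cancel₀ _ hpn.ne').symm
  have hc0 : ∀ a, 0 ≤ c a := fun a => div_nonneg (Nat.cast_nonneg _) hpn.le
  have hcρ : ∀ a, c a ≤ ρ := fun a => (div_le_iff₀ hpn).2 (hρ a)
  clear_value c
  have hc1 : ∀ a, c a ≤ 1 := fun a => (hcρ a).trans hρ1
  -- The index `i` is left out so that the marginals involve distinct indices. It never counts, as
  -- no vertex lies in its own `R`.
  set J : (ι → V) → ℝ := fun x => ∑ j ∈ Finset.univ.erase i, r (x i) (x j) with hJ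
  have hJcard : ∀ x : ι → V, ((Finset.univ.filter fun j => x j ∈ R (x i)).card : ℝ) = J x := by
    intro x
    have h0 : r (x i) (x i) = 0 := hradj _ _ (G.irrefl)
    simp only [hJ]
    rw [Finset.sum_erase (f := fun j => r (x i) (x j)) _ h0]
    simp [hr]
  clear_value r J
  have hI : ((Finset.univ.erase i).card : ℝ) = m - 1 := by
    rw [Finset.card_erase_of_mem (Finset.mem_univ i), Finset.card_univ, Nat.cast_sub (by omega)]
    simp [hmdef]
  set P : ℝ := ∑ a, c a with hP
  set Q : ℝ := ∑ a, c a ^ 2 with hQ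
  have hPn : P ≤ n := by
    refine (Finset.sum_le_sum fun a _ => hc1 a).trans_eq ?_
    simp [hndef]
  have hQn : Q ≤ n := by
    refine (Finset.sum_le_sum fun a _ => pow_le_one₀ (hc0 a) (hc1 a)).trans_eq ?_
    simp [hndef]
  have hP0 : 0 ≤ P := Finset.sum_nonneg fun a _ => hc0 a
  have hQ0 : 0 ≤ Q := Finset.sum_nonneg fun a _ => sq_nonneg _
  clear_value P Q
  have S2 : ∑ x ∈ G.cliqueTuples ι, J x ^ 2 ≤
      m ^ 2 * ((1 + θ) * W3 * (p ^ 3 * n ^ 2 * Q + 2 * β * n ^ 3)) +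
        m * ((1 + θ) * W2 * (p * n * P)) := by
    have hdiag : ∀ j ∈ Finset.univ.erase i,
        ∑ x ∈ G.cliqueTuples ι, r (x i) (x j) * r (x i) (x j) ≤ (1 + θ) * W2 * (p * n * P) := by
      intro j hj
      simp only [hrr]
      refine (h.sum_two (Finset.ne_of_mem_erase hj).symm hr0 hradj).2.trans_eq ?_
      simp only [hrsum, hcR, hP, ← Finset.sum_mul]
      ring
    have hoff : ∀ j ∈ Finset.univ.erase i, ∀ l ∈ Finset.univ.erase i, j ≠ l →
        ∑ x ∈ G.cliqueTuples ι, r (x i) (x j) * r (x i) (x l) ≤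
          (1 + θ) * W3 * (p ^ 3 * n ^ 2 * Q + 2 * β * n ^ 3) := by
      intro j hj l hl hjl
      -- The factor equals `1` on clique tuples. It makes the summand vanish off triangles, as the
      -- three-point marginal requires, and turns the resulting sum into an edge count inside `R a`.
      have e1 : ∑ x ∈ G.cliqueTuples ι, r (x i) (x j) * r (x i) (x l) =
          ∑ x ∈ G.cliqueTuples ι, r (x i) (x j) * r (x i) (x l) * G.adjInd (x j) (x l) :=
        Finset.sum_congr rfl fun x hx => by
          rw [adjInd_of_adj (mem_cliqueTuples.1 hx j l hjl), mul_one]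
      rw [e1]
      refine (h.sum_three (Finset.ne_of_mem_erase hj).symm (Finset.ne_of_mem_erase hl).symm hjl
        (g := fun a b c => r a b * r a c * G.adjInd b c)
        (fun a b c => mul_nonneg (mul_nonneg (hr0 _ _) (hr0 _ _)) (adjInd_nonneg _ _)) ?_).trans ?_
      · intro a b c habc
        by_contra hne
        simp only [mul_eq_zero, not_or] at hne
        refine habc ⟨?_, ?_, ?_⟩ <;> by_contra hh
        · exact hne.1.1 (hradj _ _ hh)
        · exact hne.1.2 (hradj _ _ hh)
        · exact hne.2 (adjInd_of_not_adj hh)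
      · refine mul_le_mul_of_nonneg_left ?_ (by positivity)
        calc ∑ a, ∑ b, ∑ c, r a b * r a c * G.adjInd b c
            = ∑ a, ∑ b ∈ R a, ∑ c ∈ R a, G.adjInd b c := by
              refine Finset.sum_congr rfl fun a _ => ?_
              simp only [hrmul, Finset.mul_sum, mul_assoc]
          _ ≤ ∑ a, (p ^ 3 * n ^ 2 * c a ^ 2 + 2 * β * n ^ 2) := by
              refine Finset.sum_le_sum fun a _ => (hE a).trans_eq ?_
              rw [hcR]; ring
          _ = _ := by
              rw [Finset.sum_add_distrib, ← Finset.mul_sum, Finset.sum_const, nsmul_eq_mul,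
                Finset.card_univ, ← hndef, ← hQ]
              ring
    have hX : 0 ≤ (1 + θ) * W3 * (p ^ 3 * n ^ 2 * Q + 2 * β * n ^ 3) := by positivity
    have hY : 0 ≤ (1 + θ) * W2 * (p * n * P) := by positivity
    calc ∑ x ∈ G.cliqueTuples ι, J x ^ 2 = ∑ j ∈ Finset.univ.erase i, ∑ l ∈ Finset.univ.erase i,
          ∑ x ∈ G.cliqueTuples ι, r (x i) (x j) * r (x i) (x l) := by
          simp only [hJ, sq, Finset.sum_mul_sum]
          rw [Finset.sum_comm]
          exact Finset.sum_congr rfl fun a _ => Finset.sum_comm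
      _ ≤ ∑ j ∈ Finset.univ.erase i, ∑ l ∈ Finset.univ.erase i,
          ((1 + θ) * W3 * (p ^ 3 * n ^ 2 * Q + 2 * β * n ^ 3) +
            if j = l then (1 + θ) * W2 * (p * n * P) else 0) := by
          refine Finset.sum_le_sum fun j hj => Finset.sum_le_sum fun l hl => ?_
          by_cases hjl : j = l
          · subst hjl
            rw [if_pos rfl]
            exact (hdiag j hj).trans (le_add_of_nonneg_left hX)
          · rw [if_neg hjl, add_zero]
            exact hoff j hj l hl hjl
      _ = (m - 1) ^ 2 * ((1 + θ) * W3 * (p ^ 3 * n ^ 2 * Q + 2 * β * n ^ 3)) +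
          (m - 1) * ((1 + θ) * W2 * (p * n * P)) := by
          simp only [Finset.sum_add_distrib, Finset.sum_const, nsmul_eq_mul, Finset.sum_ite_eq,
            Finset.sum_ite_mem, Finset.inter_self, hI]
          ring
      _ ≤ _ := by
          gcongr <;> linarith
  have S1 : (m - 1) * ((1 - θ) * W2 * (p * n * Q)) ≤
      ∑ x ∈ G.cliqueTuples ι, c (x i) * J x := by
    have : ∀ j ∈ Finset.univ.erase i, (1 - θ) * W2 * (p * n * Q) ≤
        ∑ x ∈ G.cliqueTuples ι, c (x i) * r (x i) (x j) := by
      intro j hj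
      refine le_trans (le_of_eq ?_) (h.sum_two (Finset.ne_of_mem_erase hj).symm
        (g := fun a b => c a * r a b) (fun a b => mul_nonneg (hc0 a) (hr0 a b))
        fun a b hab => by rw [hradj a b hab, mul_zero]).1
      simp only [← Finset.mul_sum, hrsum, hcR, hQ]
      rw [Finset.mul_sum]
      congr 1
      exact Finset.sum_congr rfl fun a _ => by ring
    calc _ ≤ ∑ j ∈ Finset.univ.erase i, ∑ x ∈ G.cliqueTuples ι, c (x i) * r (x i) (x j) := by
          refine le_trans (le_of_eq ?_) (Finset.card_nsmul_le_sum _ _ _ this)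
          rw [nsmul_eq_mul, hI]
      _ = _ := by
          simp only [hJ, Finset.mul_sum]
          exact Finset.sum_comm
  have S0 : ∑ x ∈ G.cliqueTuples ι, c (x i) ^ 2 ≤ (1 + θ) * W1 * Q := by
    rw [hQ]
    exact (h.sum_one i (g := fun a => c a ^ 2) fun a => sq_nonneg _).2
  have hvar : ∑ x ∈ G.cliqueTuples ι, (J x - c (x i) * m) ^ 2 ≤
      m ^ 2 * ((4 * θ + 4 / m + 4 * β / p ^ 3) * W0) := by
    have hexp : ∑ x ∈ G.cliqueTuples ι, (J x - c (x i) * m) ^ 2 =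
        ∑ x ∈ G.cliqueTuples ι, J x ^ 2 - 2 * m * ∑ x ∈ G.cliqueTuples ι, c (x i) * J x +
          m ^ 2 * ∑ x ∈ G.cliqueTuples ι, c (x i) ^ 2 := by
      simp only [Finset.mul_sum, ← Finset.sum_add_distrib, ← Finset.sum_sub_distrib]
      exact Finset.sum_congr rfl fun x _ => by ring
    rw [hexp]
    rw [hW0, hW1, hW2]
    rw [hW1, hW2] at S0
    rw [hW2] at S1 S2
    exact variance_bound_aux hn0 hm3 hp0 hθ0 hθ1 hβ hW3 hPn hQn S2 S1 S0
  set bad := (G.cliqueTuples ι).filter fun x => (ρ + γ) * m <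
      ((Finset.univ.filter fun j => x j ∈ R (x i)).card : ℝ) with hbad
  have hcheb : (bad.card : ℝ) * (γ * m) ^ 2 ≤ ∑ x ∈ G.cliqueTuples ι, (J x - c (x i) * m) ^ 2 := by
    refine le_trans ?_ (Finset.sum_le_sum_of_subset_of_nonneg
      (show bad ⊆ G.cliqueTuples ι from Finset.filter_subset _ _) fun _ _ _ => sq_nonneg _)
    rw [← nsmul_eq_mul]
    refine Finset.card_nsmul_le_sum _ _ _ fun x hx => ?_
    have hx2 := (Finset.mem_filter.1 hx).2
    rw [hJcard] at hx2
    have := mul_le_mul_of_nonneg_right (hcρ (x i)) (show 0 ≤ m by positivity)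
    have : γ * m ≤ J x - c (x i) * m := by linarith
    exact pow_le_pow_left₀ (by positivity) this 2
  have hm2 : 0 < m ^ 2 := by positivity
  refine le_of_mul_le_mul_left ?_ hm2
  calc _ = (bad.card : ℝ) * (γ * m) ^ 2 := by ring
    _ ≤ _ := hcheb.trans hvar

end Averaging

end SimpleGraph

/-! ### Turán's theorem inside one clique tuple -/

namespace SimpleGraph

section Turan

open scoped Classical

/-- Turán's theorem in terms of the number of ordered non-adjacent pairs. -/
theorem CliqueFree.card_sq_le_mul_card_not_adj {α : Type*} [Fintype α] {K : SimpleGraph α} {s : ℕ}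
    (h : K.CliqueFree (s + 1)) :
    Fintype.card α ^ 2 ≤ s * (Finset.univ.filter fun e : α × α => ¬ K.Adj e.1 e.2).card := by
  rcases Nat.eq_zero_or_pos s with rfl | hs
  · have : IsEmpty α := ⟨fun a => h {a} (by simp [isNClique_iff])⟩
    simp
  · have h1 : K.edgeFinset.card ≤ (turanGraph (Fintype.card α) s).edgeFinset.card := by
      rw [card_edgeFinset_turanGraph]
      convert h.card_edgeFinset_le
    have h2 : 2 * s * K.edgeFinset.card ≤ (s - 1) * Fintype.card α ^ 2 := by
      refine le_trans ?_ (mul_card_edgeFinset_turanGraph_le (n := Fintype.card α) (r := s))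
      gcongr
    have h3 : (Finset.univ.filter fun e : α × α => K.Adj e.1 e.2).card =
        2 * K.edgeFinset.card := by
      rw [← sum_degrees_eq_twice_card_edges, ← Finset.univ_product_univ, Finset.card_filter,
        Finset.sum_product]
      refine Finset.sum_congr rfl fun a _ => ?_
      rw [← Finset.card_filter, ← card_neighborFinset_eq_degree, neighborFinset_eq_filter]
    have h4 := Finset.card_filter_add_card_filter_not (s := (Finset.univ : Finset (α × α)))
      (fun e => K.Adj e.1 e.2)
    rw [Finset.card_univ, Fintype.card_prod, ← sq, h3] at h4
    obtain ⟨t, rfl⟩ : ∃ t, s = t + 1 := ⟨s - 1, by omega⟩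
    simp only [Nat.add_sub_cancel] at h2
    nlinarith

theorem card_sq_le_or_exists_clique {ι : Type*} [Fintype ι] (K : SimpleGraph ι) (Y : Finset ι)
    (s : ℕ) :
    Y.card ^ 2 ≤ s * ((Y ×ˢ Y).filter fun e => ¬ K.Adj e.1 e.2).card ∨
      ∃ f : Fin (s + 1) → ι, (∀ a, f a ∈ Y) ∧ ∀ a b, a ≠ b → K.Adj (f a) (f b) := by
  by_cases h : (K.induce (Y : Set ι)).CliqueFree (s + 1)
  · left
    have h1 := h.card_sq_le_mul_card_not_adj
    have h2 : (Finset.univ.filter fun e : (↥(Y : Set ι)) × (↥(Y : Set ι)) =>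
        ¬ (K.induce (Y : Set ι)).Adj e.1 e.2).card ≤
        ((Y ×ˢ Y).filter fun e => ¬ K.Adj e.1 e.2).card := by
      refine Finset.card_le_card_of_injOn (fun e => ((e.1 : ι), (e.2 : ι))) ?_ ?_
      · rintro ⟨a, b⟩ hab
        simpa using hab
      · rintro ⟨a, b⟩ _ ⟨c, d⟩ _ h
        rw [Prod.mk.injEq] at h
        exact Prod.ext (Subtype.ext h.1) (Subtype.ext h.2)
    have h3 : Fintype.card (Y : Set ι) = Y.card := Fintype.card_ofFinset Y fun _ => Iff.rfl
    rw [h3] at h1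
    exact h1.trans (Nat.mul_le_mul_left _ h2)
  · right
    let e := topEmbeddingOfNotCliqueFree h
    refine ⟨fun a => (e a : ι), fun a => (e a).2, fun a b hab => ?_⟩
    exact e.map_rel_iff.2 hab

end Turan

section Pointwise

open scoped Classical

variable {V ι : Type*} [Fintype V] [Fintype ι] {G G' : SimpleGraph V}

/-- The cliques `(y₀, …, yₖ)` of `G` such that `v` is adjacent to all of `y₀, …, yₖ₋₁`. -/
noncomputable def rootedCliqueTuples (G : SimpleGraph V) (v : V) (k : ℕ) :
    Finset (Fin (k + 1) → V) :=
  (G.cliqueTuples (Fin (k + 1))).filter fun y => ∀ i : Fin k, G.Adj v (y i.castSucc)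

/-- The neighbours of `u` in `G` that are not neighbours in `G'`. -/
noncomputable def deletedNbhd (G G' : SimpleGraph V) (u : V) : Finset V :=
  Finset.univ.filter fun a => G.Adj u a ∧ ¬ G'.Adj u a

theorem mem_deletedNbhd {u a : V} : a ∈ G.deletedNbhd G' u ↔ G.Adj u a ∧ ¬ G'.Adj u a := by
  simp [deletedNbhd]

/-- Inside a clique tuple `x` of `G`, the neighbours of `v` in `G'` that have few deleted edges
within `x` either span many non-adjacent pairs, or `x` contains a rooted clique. -/
theorem card_sq_le_of_mem_cliqueTuples {x : ι → V} (hx : x ∈ G.cliqueTuples ι)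
    (hG' : G' ≤ G) (v : V) (s : ℕ) {L : ℝ} (hL : (s + 1) * (1 + L) < Fintype.card ι) :
    ((Finset.univ.filter fun i => G'.Adj v (x i) ∧
      ((Finset.univ.filter fun j => x j ∈ G.deletedNbhd G' (x i)).card : ℝ) ≤ L).card : ℝ) ^ 2 ≤
    s * (Fintype.card ι + ((Finset.univ.filter fun e : ι × ι => (G.Adj v (x e.1) ∧
      G.Adj v (x e.2)) ∧ x e.2 ∈ G.deletedNbhd G' (x e.1)).card : ℝ)) +
    Fintype.card ι ^ 2 * ((Finset.univ.filter fun τ : Fin (s + 2) → ι =>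
      x ∘ τ ∈ G'.rootedCliqueTuples v (s + 1)).card : ℝ) := by
  set Y := Finset.univ.filter fun i => G'.Adj v (x i) ∧
      ((Finset.univ.filter fun j => x j ∈ G.deletedNbhd G' (x i)).card : ℝ) ≤ L with hY
  have hnot : ∀ i j, ¬ G'.Adj (x i) (x j) → i = j ∨ x j ∈ G.deletedNbhd G' (x i) := by
    intro i j hij
    by_cases h : i = j
    · exact .inl h
    · exact .inr (mem_deletedNbhd.2 ⟨mem_cliqueTuples.1 hx i j h, hij⟩)
  rcases card_sq_le_or_exists_clique (G'.comap x) Y s with h | ⟨f, hfY, hf⟩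
  · have h1 : ((Y ×ˢ Y).filter fun e => ¬ (G'.comap x).Adj e.1 e.2).card ≤ Fintype.card ι +
        (Finset.univ.filter fun e : ι × ι => (G.Adj v (x e.1) ∧
          G.Adj v (x e.2)) ∧ x e.2 ∈ G.deletedNbhd G' (x e.1)).card := by
      have hd : (Finset.univ.image fun i : ι => (i, i)).card ≤ Fintype.card ι :=
        Finset.card_image_le
      refine le_trans (Finset.card_le_card ?_) ((Finset.card_union_le
        (Finset.univ.image fun i : ι => (i, i)) _).trans (Nat.add_le_add_right hd _))
      rintro ⟨i, j⟩ hij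
      simp only [Finset.mem_filter, Finset.mem_product, hY, Finset.mem_univ, true_and,
        comap_adj] at hij
      rw [Finset.mem_union]
      rcases hnot i j hij.2 with rfl | h
      · exact .inl (Finset.mem_image_of_mem _ (Finset.mem_univ _))
      · exact .inr (Finset.mem_filter.2 ⟨Finset.mem_univ _,
          ⟨hG' hij.1.1.1, hG' hij.1.2.1⟩, h⟩)
    have h2 : ((Y.card ^ 2 : ℕ) : ℝ) ≤ ((s * (Fintype.card ι +
        (Finset.univ.filter fun e : ι × ι => (G.Adj v (x e.1) ∧
          G.Adj v (x e.2)) ∧ x e.2 ∈ G.deletedNbhd G' (x e.1)).card) : ℕ) : ℝ) :=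
      Nat.cast_le.2 (h.trans (Nat.mul_le_mul_left _ h1))
    push_cast at h2
    exact h2.trans (le_add_of_nonneg_right (by positivity))
  -- Each of the `s + 1` clique vertices excludes at most `1 + L` indices, its own and those behind
  -- deleted edges. By `hL` these cannot cover all of `ι`.
  · obtain ⟨j, hj⟩ : ∃ j, ∀ a, G'.Adj (x (f a)) (x j) := by
      by_contra! hno
      have h1 : (Finset.univ : Finset ι) ⊆ Finset.univ.biUnion fun a : Fin (s + 1) =>
          insert (f a) (Finset.univ.filter fun j => x j ∈ G.deletedNbhd G' (x (f a))) := by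
        intro j _
        obtain ⟨a, ha⟩ := hno j
        simp only [Finset.mem_biUnion, Finset.mem_insert, Finset.mem_filter, Finset.mem_univ,
          true_and]
        exact ⟨a, (hnot _ _ ha).imp Eq.symm id⟩
      have h2 := (Finset.card_le_card h1).trans Finset.card_biUnion_le
      have h3 : ((Fintype.card ι : ℕ) : ℝ) ≤ ∑ a : Fin (s + 1), ((insert (f a)
          (Finset.univ.filter fun j => x j ∈ G.deletedNbhd G' (x (f a)))).card : ℝ) := by
        exact_mod_cast h2
      have h4 := h3.trans (Finset.sum_le_card_nsmul _ _ (1 + L) fun a _ => by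
        have := (Finset.mem_filter.1 (hfY a)).2.2
        have h5 := Finset.card_insert_le (f a)
          (Finset.univ.filter fun j => x j ∈ G.deletedNbhd G' (x (f a)))
        have h6 := Nat.cast_le (α := ℝ).2 h5
        push_cast at h6
        linarith)
      simp only [Finset.card_univ, Fintype.card_fin, nsmul_eq_mul] at h4
      push_cast at h4
      linarith
    -- The new vertex goes to the last slot, the one that need not be adjacent to `v`.
    have hτ : x ∘ (Fin.snoc f j : Fin (s + 2) → ι) ∈ G'.rootedCliqueTuples v (s + 1) := by
      rw [rootedCliqueTuples, Finset.mem_filter, mem_cliqueTuples]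
      constructor
      · intro a b hab
        induction a using Fin.lastCases with
        | last =>
          induction b using Fin.lastCases with
          | last => exact absurd rfl hab
          | cast b =>
            simp only [Function.comp, Fin.snoc_last, Fin.snoc_castSucc]
            exact (hj b).symm
        | cast a =>
          induction b using Fin.lastCases with
          | last =>
            simp only [Function.comp, Fin.snoc_last, Fin.snoc_castSucc]
            exact hj a
          | cast b =>
            simp only [Function.comp, Fin.snoc_castSucc]
            exact hf a b fun e => hab (e ▸ rfl)
      · intro i
        simp only [Function.comp, Fin.snoc_castSucc]
        exact (Finset.mem_filter.1 (hfY i)).2.1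
    -- One rooted tuple already suffices, since the trivial bound is `|Y| ≤ m`.
    have h1 : (1 : ℝ) ≤ ((Finset.univ.filter fun τ : Fin (s + 2) → ι =>
        x ∘ τ ∈ G'.rootedCliqueTuples v (s + 1)).card : ℝ) := by
      have : 0 < (Finset.univ.filter fun τ : Fin (s + 2) → ι =>
        x ∘ τ ∈ G'.rootedCliqueTuples v (s + 1)).card :=
        Finset.card_pos.2 ⟨_, Finset.mem_filter.2 ⟨Finset.mem_univ _, hτ⟩⟩
      exact_mod_cast this
    have h2 : (Y.card : ℝ) ^ 2 ≤ Fintype.card ι ^ 2 := by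
      gcongr
      exact Y.card_le_univ
    refine (h2.trans (le_mul_of_one_le_right (by positivity) h1)).trans
      (le_add_of_nonneg_left (by positivity))

end Pointwise

end SimpleGraph

/-! ### Averaging over clique tuples and poor vertices -/

namespace SimpleGraph

section MainInequality

open scoped Classical

variable {V ι : Type*} [Fintype V] [Fintype ι] {G G' : SimpleGraph V} {p θ δ : ℝ}

theorem card_deletedNbhd_le (hG' : G' ≤ G) {m : ℕ} (hG : G.JointNbhdsRegular p δ m) (hm : 3 ≤ m)
    {q : ℝ} (hdeg : ∀ u, q * (p * Fintype.card V) ≤ ∑ b, G'.adjInd u b) (u : V) :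
    ((G.deletedNbhd G' u).card : ℝ) ≤ (1 + δ - q) * (p * Fintype.card V) := by
  have h : ((G.deletedNbhd G' u).card : ℝ) = ∑ b, G.adjInd u b - ∑ b, G'.adjInd u b := by
    rw [deletedNbhd, Finset.card_filter, Nat.cast_sum, ← Finset.sum_sub_distrib]
    refine Finset.sum_congr rfl fun b _ => ?_
    by_cases h' : G'.Adj u b
    · simp [adjInd, h', hG' h']
    · by_cases h : G.Adj u b <;> simp [adjInd, h, h']
  rw [h]
  linarith [(hG.sum_adjInd hm u).2, hdeg u]

/-- The number of indices at which the clique tuple `x` is adjacent to `v` in `G'` and sees few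
deleted edges. -/
noncomputable def goodCount (G G' : SimpleGraph V) (L : ℝ) (v : V) (x : ι → V) : ℝ :=
  ((Finset.univ.filter fun i => G'.Adj v (x i) ∧
    ((Finset.univ.filter fun j => x j ∈ G.deletedNbhd G' (x i)).card : ℝ) ≤ L).card : ℝ)

/-- At each index, the one-point marginal gives the tuples with `x i` in the `G'`-neighbourhood of
`v`; those with too many deleted edges at `x i` are subtracted by `hbad`. -/
theorem HasRegularMarginals.le_sum_goodCount (h : G.HasRegularMarginals ι p θ)
    (hp0 : 0 ≤ p) (hθ1 : θ ≤ 1) {q : ℝ} {v : V}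
    (hdeg : q * (p * Fintype.card V) ≤ ∑ b, G'.adjInd v b) {L W : ℝ}
    (hbad : ∀ i, (((G.cliqueTuples ι).filter fun x => L <
      ((Finset.univ.filter fun j => x j ∈ G.deletedNbhd G' (x i)).card : ℝ)).card : ℝ) ≤ W) :
    Fintype.card ι * ((1 - θ) * extensionWeight p (Fintype.card V) (Fintype.card ι) 1 *
      (q * (p * Fintype.card V)) - W) ≤ ∑ x ∈ G.cliqueTuples ι, goodCount G G' L v x := by
  set bad : ι → (ι → V) → ℝ := fun i x => if L < ((Finset.univ.filter fun j =>
    x j ∈ G.deletedNbhd G' (x i)).card : ℝ) then 1 else 0 with hbaddef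
  have hpt : ∀ x, ∑ i, (G'.adjInd v (x i) - bad i x) ≤ goodCount G G' L v x := by
    intro x
    rw [goodCount, Finset.card_filter, Nat.cast_sum]
    refine Finset.sum_le_sum fun i _ => ?_
    simp only [hbaddef, adjInd]
    by_cases h1 : G'.Adj v (x i)
    · by_cases h2 : L < ((Finset.univ.filter fun j =>
        x j ∈ G.deletedNbhd G' (x i)).card : ℝ)
      · simp only [h1, h2, not_le.2 h2, if_true]; norm_num
      · simp only [h1, h2, not_lt.1 h2, if_true]; norm_num
    · simp only [h1, if_false, false_and]
      split_ifs <;> norm_num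
  have hW := extensionWeight_nonneg hp0 (Fintype.card V) (Fintype.card ι) 1
  calc _ ≤ ∑ i, ∑ x ∈ G.cliqueTuples ι, (G'.adjInd v (x i) - bad i x) := by
        rw [← nsmul_eq_mul]
        refine Finset.card_nsmul_le_sum _ _ _ fun i _ => ?_
        rw [Finset.sum_sub_distrib]
        refine sub_le_sub ?_ ?_
        · refine le_trans ?_ (h.sum_one i (g := fun a => G'.adjInd v a)
            fun a => adjInd_nonneg _ _).1
          exact mul_le_mul_of_nonneg_left hdeg (mul_nonneg (by linarith) hW)
        · refine le_trans (le_of_eq ?_) (hbad i)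
          rw [Finset.card_filter, Nat.cast_sum]
          simp [hbaddef]
    _ = ∑ x ∈ G.cliqueTuples ι, ∑ i, (G'.adjInd v (x i) - bad i x) := Finset.sum_comm
    _ ≤ _ := Finset.sum_le_sum fun x _ => hpt x

/-- Each choice of positions `τ` contributes the number of rooted cliques times the extension weight
of a `(k + 1)`-clique, which costs only a power of `p` against the total. So a small `c` makes
rooted cliques rare inside random tuples. -/
theorem HasRegularMarginals.sum_card_rooted_le (h : G.HasRegularMarginals ι p θ) (hG' : G' ≤ G)
    (hp0 : 0 < p) (hp1 : p ≤ 1) (hθ0 : 0 ≤ θ) {k : ℕ} (hk : k + 1 ≤ Fintype.card ι) {v : V}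
    {c : ℝ} (hc : ((G'.rootedCliqueTuples v k).card : ℝ) ≤ c * (Fintype.card V : ℝ) ^ (k + 1)) :
    ∑ x ∈ G.cliqueTuples ι, ((Finset.univ.filter fun τ : Fin (k + 1) → ι =>
        x ∘ τ ∈ G'.rootedCliqueTuples v k).card : ℝ) ≤
      (Fintype.card ι : ℝ) ^ (k + 1) * ((1 + θ) * (c / p ^ ((k + 1) * (k + 1)) *
        extensionWeight p (Fintype.card V) (Fintype.card ι) 0)) := by
  set F := G'.rootedCliqueTuples v k with hF
  have hFc : ∀ y ∈ F, y ∈ G.cliqueTuples (Fin (k + 1)) := by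
    intro y hy
    rw [hF, rootedCliqueTuples, Finset.mem_filter, mem_cliqueTuples] at hy
    exact mem_cliqueTuples.2 fun i j hij => hG' (hy.1 i j hij)
  have hW := extensionWeight_nonneg hp0.le (Fintype.card V) (Fintype.card ι) (k + 1)
  have hW' := pow_mul_extensionWeight_le (n := Fintype.card V) hp0.le hp1 hk
  have hbound : (1 + θ) * extensionWeight p (Fintype.card V) (Fintype.card ι) (k + 1) * F.card ≤
      (1 + θ) * (c / p ^ ((k + 1) * (k + 1)) *
        extensionWeight p (Fintype.card V) (Fintype.card ι) 0) := by
    rw [mul_assoc]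
    refine mul_le_mul_of_nonneg_left ?_ (by linarith)
    have hpk : 0 < p ^ ((k + 1) * (k + 1)) := by positivity
    rw [div_mul_eq_mul_div, le_div_iff₀ hpk]
    rcases le_or_gt 0 c with h0 | h0
    · calc _ ≤ extensionWeight p (Fintype.card V) (Fintype.card ι) (k + 1) *
            (c * (Fintype.card V : ℝ) ^ (k + 1)) * p ^ ((k + 1) * (k + 1)) := by gcongr
        _ = c * (p ^ ((k + 1) * (k + 1)) * (Fintype.card V : ℝ) ^ (k + 1) *
            extensionWeight p (Fintype.card V) (Fintype.card ι) (k + 1)) := by ring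
        _ ≤ _ := mul_le_mul_of_nonneg_left hW' h0
    -- A negative `c` is compatible with `hc` only on an empty vertex set, where both sides vanish.
    · have hV : Fintype.card V = 0 := by
        by_contra hne
        have : (0 : ℝ) < Fintype.card V := by exact_mod_cast Nat.pos_of_ne_zero hne
        have h1 : c * (Fintype.card V : ℝ) ^ (k + 1) < 0 := mul_neg_of_neg_of_pos h0 (by positivity)
        have h2 : (0 : ℝ) ≤ F.card := Nat.cast_nonneg _
        linarith
      have h1 : extensionWeight p (Fintype.card V) (Fintype.card ι) 0 = 0 := by
        rw [extensionWeight_eq_mul (by omega), hV]; simp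
      have h2 : (F.card : ℝ) = 0 := by
        refine le_antisymm (hc.trans_eq ?_) (Nat.cast_nonneg _)
        simp [hV]
      rw [h1, h2]; simp
  calc _ = ∑ τ : Fin (k + 1) → ι, ∑ x ∈ G.cliqueTuples ι, (if x ∘ τ ∈ F then (1 : ℝ) else 0) := by
        rw [Finset.sum_comm]
        refine Finset.sum_congr rfl fun x _ => ?_
        rw [Finset.card_filter, Nat.cast_sum]
        simp
    _ ≤ ∑ _τ : Fin (k + 1) → ι, (1 + θ) *
        extensionWeight p (Fintype.card V) (Fintype.card ι) (k + 1) * F.card := by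
        refine Finset.sum_le_sum fun τ _ => ?_
        by_cases hτ : Function.Injective τ
        · refine (h τ hτ (fun y => if y ∈ F then (1 : ℝ) else 0)
            (fun y => by split_ifs <;> simp) fun y hy => if_neg fun hyF => hy (hFc y hyF)).2.trans_eq
            ?_
          simp
        · refine le_trans (le_of_eq (Finset.sum_eq_zero fun x _ => if_neg fun hxF => hτ ?_))
            (by positivity)
          exact Function.Injective.of_comp (injective_of_mem_cliqueTuples (hFc _ hxF))
    _ = (Fintype.card ι : ℝ) ^ (k + 1) * ((1 + θ) *
        extensionWeight p (Fintype.card V) (Fintype.card ι) (k + 1) * F.card) := by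
        simp [Finset.sum_const]
    _ ≤ _ := mul_le_mul_of_nonneg_left hbound (by positivity)

/-- Interchange the sums: a deleted pair `(a, b)` is counted once for each `v ∈ B` adjacent to both,
that is `G.codegIn B a b` times. The two-point marginal then replaces the tuples by a sum over all
deleted pairs. -/
theorem HasRegularMarginals.sum_card_deleted_pairs_le (h : G.HasRegularMarginals ι p θ)
    (hp0 : 0 ≤ p) (hθ0 : 0 ≤ θ) (B : Finset V) :
    ∑ v ∈ B, ∑ x ∈ G.cliqueTuples ι, ((Finset.univ.filter fun e : ι × ι => (G.Adj v (x e.1) ∧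
      G.Adj v (x e.2)) ∧ x e.2 ∈ G.deletedNbhd G' (x e.1)).card : ℝ) ≤
    (Fintype.card ι : ℝ) ^ 2 * ((1 + θ) *
      extensionWeight p (Fintype.card V) (Fintype.card ι) 2 *
        ∑ a, ∑ b ∈ G.deletedNbhd G' a, G.codegIn B a b) := by
  set g : V → V → ℝ := fun a b => if b ∈ G.deletedNbhd G' a then G.codegIn B a b else 0 with hg
  have hcod : ∀ a b, 0 ≤ G.codegIn B a b := fun a b =>
    Finset.sum_nonneg fun v _ => mul_nonneg (adjInd_nonneg _ _) (adjInd_nonneg _ _)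
  have hg0 : ∀ a b, 0 ≤ g a b := fun a b => by
    simp only [hg]; split_ifs
    · exact hcod a b
    · exact le_rfl
  have hgadj : ∀ a b, ¬ G.Adj a b → g a b = 0 := fun a b hab =>
    if_neg fun hb => hab (mem_deletedNbhd.1 hb).1
  have hW := extensionWeight_nonneg hp0 (Fintype.card V) (Fintype.card ι) 2
  have hgsum : ∑ a, ∑ b, g a b = ∑ a, ∑ b ∈ G.deletedNbhd G' a, G.codegIn B a b := by
    refine Finset.sum_congr rfl fun a _ => ?_
    simp [hg]
  calc _ = ∑ i : ι, ∑ j : ι, ∑ x ∈ G.cliqueTuples ι, g (x i) (x j) := by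
        have : ∀ x : ι → V, ∀ v, ((Finset.univ.filter fun e : ι × ι => (G.Adj v (x e.1) ∧
            G.Adj v (x e.2)) ∧ x e.2 ∈ G.deletedNbhd G' (x e.1)).card : ℝ) =
            ∑ i, ∑ j, if x j ∈ G.deletedNbhd G' (x i) then
              G.adjInd v (x i) * G.adjInd v (x j) else 0 := by
          intro x v
          rw [Finset.card_filter, Nat.cast_sum, ← Finset.univ_product_univ, Finset.sum_product]
          refine Finset.sum_congr rfl fun i _ => Finset.sum_congr rfl fun j _ => ?_
          by_cases h1 : G.Adj v (x i) <;> by_cases h2 : G.Adj v (x j) <;>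
            by_cases h3 : x j ∈ G.deletedNbhd G' (x i) <;> simp [adjInd, h1, h2, h3]
        simp only [this]
        rw [Finset.sum_comm]
        have h2 : ∀ x : ι → V, ∑ v ∈ B, ∑ i, ∑ j, (if x j ∈ G.deletedNbhd G' (x i) then
              G.adjInd v (x i) * G.adjInd v (x j) else 0) = ∑ i, ∑ j, g (x i) (x j) := by
          intro x
          rw [Finset.sum_comm]
          refine Finset.sum_congr rfl fun i _ => ?_
          rw [Finset.sum_comm]
          refine Finset.sum_congr rfl fun j _ => ?_
          simp only [hg, codegIn]
          split_ifs <;> simp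
        simp only [h2]
        rw [Finset.sum_comm]
        exact Finset.sum_congr rfl fun i _ => Finset.sum_comm
    _ ≤ ∑ _i : ι, ∑ _j : ι, (1 + θ) * extensionWeight p (Fintype.card V) (Fintype.card ι) 2 *
        ∑ a, ∑ b, g a b := by
        refine Finset.sum_le_sum fun i _ => Finset.sum_le_sum fun j _ => ?_
        by_cases hij : i = j
        · subst hij
          refine le_trans (le_of_eq (Finset.sum_eq_zero fun x _ => hgadj _ _ G.irrefl)) ?_
          exact mul_nonneg (mul_nonneg (by linarith) hW)
            (Finset.sum_nonneg fun a _ => Finset.sum_nonneg fun b _ => hg0 a b)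
        · exact (h.sum_two hij hg0 hgadj).2
    _ = _ := by
        rw [hgsum]
        simp only [Finset.sum_const, Finset.card_univ, nsmul_eq_mul]
        ring

/-- If all vertices of `B` are the root of few cliques, then the parameters satisfy an inequality
which fails when `B` is large and the error terms are small. -/
theorem averaged_inequality (hG : G.JointNbhdsRegular p δ (Fintype.card ι))
    (h : G.HasRegularMarginals ι p θ) (hG' : G' ≤ G) (hp0 : 0 < p) (hp1 : p ≤ 1) {s : ℕ}
    (hs : s + 2 ≤ Fintype.card ι) (hm : 3 ≤ Fintype.card ι) (hδ0 : 0 ≤ δ) (hδ1 : δ ≤ 1 / 3)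
    (hθ0 : 0 ≤ θ) (hθ1 : θ ≤ 1) (hn0 : 0 < Fintype.card V) {β : ℝ} (hβ : 0 < β)
    (hn : 3 * δ * Fintype.card V + 1 ≤ 4 * β ^ 2 * Fintype.card V) {q : ℝ} (hq : δ ≤ q)
    (hdeg : ∀ u, q * (p * Fintype.card V) ≤ ∑ b, G'.adjInd u b) {γ : ℝ} (hγ : 0 < γ)
    (hL : (s + 1) * (1 + (1 + δ - q + γ) * Fintype.card ι) < Fintype.card ι) {τ : ℝ} (hτ : 0 < τ)
    {B : Finset V} (hB0 : B.Nonempty) (hB : 7 * δ * (B.card * p ^ 2) ≤ 1) {c : ℝ}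
    (hc : ∀ v ∈ B, ((G'.rootedCliqueTuples v (s + 1)).card : ℝ) ≤
      c * (Fintype.card V : ℝ) ^ (s + 2)) :
    q ^ 2 * (1 - 3 * θ) -
        2 * q * ((4 * θ + 4 / Fintype.card ι + 4 * β / p ^ 3) / γ ^ 2) / p ≤
      s * ((1 + θ) / (Fintype.card ι * p ^ 2) +
        (1 + θ) * ((1 + τ) * (1 + δ - q) + 3 / (4 * τ * (B.card * p ^ 2)))) +
      (1 + θ) * (Fintype.card ι : ℝ) ^ (s + 2) * c / p ^ ((s + 2) * (s + 2)) / p ^ 2 := by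
  set L : ℝ := (1 + δ - q + γ) * Fintype.card ι with hLdef
  set η : ℝ := (4 * θ + 4 / Fintype.card ι + 4 * β / p ^ 3) / γ ^ 2 with hη
  have hRcard := fun u => card_deletedNbhd_le hG' hG hm hdeg u
  have hbad : ∀ i, (((G.cliqueTuples ι).filter fun x => L <
      ((Finset.univ.filter fun j => x j ∈ G.deletedNbhd G' (x i)).card : ℝ)).card : ℝ) ≤
      η * extensionWeight p (Fintype.card V) (Fintype.card ι) 0 := by
    intro i
    have := h.card_filter_large_le hm hp0 hθ0 hθ1 hβ.le (R := fun u => G.deletedNbhd G' u)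
      (fun a b hb => (mem_deletedNbhd.1 hb).1) (ρ := 1 + δ - q) (by linarith) hRcard
      (fun a => hG.sum_sum_adjInd_le hm hp0.le hp1 hδ0 hβ hn _) hn0 hγ i
    have hγ2 : 0 < γ ^ 2 := by positivity
    rw [hη, div_mul_eq_mul_div, le_div_iff₀ hγ2, mul_comm]
    exact this
  have hlow := fun v => h.le_sum_goodCount hp0.le hθ1 (hdeg v) hbad
  have hpt := fun (x : ι → V) (hx : x ∈ G.cliqueTuples ι) v =>
    card_sq_le_of_mem_cliqueTuples hx hG' v s hL
  have hN := fun v hv => h.sum_card_rooted_le hG' hp0 hp1 hθ0 (k := s + 1) (by omega) (hc v hv)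
  have hP := h.sum_card_deleted_pairs_le (G' := G') hp0.le hθ0 B
  have hD := hG.sum_sum_codegIn_le hm hp0 hδ0 hδ1 hB0 hB hτ
    (R := fun u => G.deletedNbhd G' u) (fun a b hb => (mem_deletedNbhd.1 hb).1) hRcard
  have hΩ := h.card_cliqueTuples
  obtain ⟨hW1, hW2, hW0⟩ := extensionWeight_recursions (p := p) (n := Fintype.card V) hm
  have hWpos : 0 < extensionWeight p (Fintype.card V) (Fintype.card ι) 0 :=
    extensionWeight_pos hp0 hn0 _ _
  have hW2pos : 0 < extensionWeight p (Fintype.card V) (Fintype.card ι) 2 :=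
    extensionWeight_pos hp0 hn0 _ _
  have hm0 : (0 : ℝ) < Fintype.card ι := by exact_mod_cast (by omega : 0 < Fintype.card ι)
  have hk0 : (0 : ℝ) < B.card := Nat.cast_pos.2 hB0.card_pos
  have hnn : (0 : ℝ) < Fintype.card V := Nat.cast_pos.2 hn0
  have hq0 : 0 ≤ q := hδ0.trans hq
  set μ : ℝ := q * p * Fintype.card ι with hμ
  have hμ0 : 0 ≤ μ := by positivity
  generalize extensionWeight p (Fintype.card V) (Fintype.card ι) 0 = W0 at *
  generalize extensionWeight p (Fintype.card V) (Fintype.card ι) 1 = W1 at *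
  generalize extensionWeight p (Fintype.card V) (Fintype.card ι) 2 = W2 at *
  have hWW : W0 = p * (Fintype.card V : ℝ) ^ 2 * W2 := by rw [hW0, hW1]; ring
  -- Cauchy–Schwarz in the linear form `Y² ≥ 2 μ Y - μ²`, with `μ = q p m` the expected size of `Y`
  -- apart from errors.
  have hsq : ∀ v, W0 * (μ ^ 2 * (1 - 3 * θ) - 2 * μ * η * Fintype.card ι) ≤
      ∑ x ∈ G.cliqueTuples ι, goodCount G G' L v x ^ 2 := by
    intro v
    have h1 : ∑ x ∈ G.cliqueTuples ι, (2 * μ * goodCount G G' L v x - μ ^ 2) ≤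
        ∑ x ∈ G.cliqueTuples ι, goodCount G G' L v x ^ 2 :=
      Finset.sum_le_sum fun x _ => by nlinarith [sq_nonneg (goodCount G G' L v x - μ)]
    rw [Finset.sum_sub_distrib, ← Finset.mul_sum, Finset.sum_const, nsmul_eq_mul] at h1
    have h2 := mul_le_mul_of_nonneg_left (hlow v) (show 0 ≤ 2 * μ by positivity)
    have h3 := mul_le_mul_of_nonneg_right hΩ (sq_nonneg μ)
    have h4 : (Fintype.card ι : ℝ) * ((1 - θ) * W1 * (q * (p * Fintype.card V)) - η * W0) =
        W0 * ((1 - θ) * μ - η * Fintype.card ι) := by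
      rw [hW0, hμ]; ring
    rw [h4] at h2
    linarith
  have hup : ∀ v ∈ B, ∑ x ∈ G.cliqueTuples ι, goodCount G G' L v x ^ 2 ≤
      s * (Fintype.card ι * ((1 + θ) * W0) + ∑ x ∈ G.cliqueTuples ι,
        ((Finset.univ.filter fun e : ι × ι => (G.Adj v (x e.1) ∧
          G.Adj v (x e.2)) ∧ x e.2 ∈ G.deletedNbhd G' (x e.1)).card : ℝ)) +
      (Fintype.card ι : ℝ) ^ 2 * ((Fintype.card ι : ℝ) ^ (s + 2) * ((1 + θ) *
        (c / p ^ ((s + 2) * (s + 2)) * W0))) := by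
    intro v hv
    refine (Finset.sum_le_sum fun x hx => hpt x hx v).trans ?_
    rw [Finset.sum_add_distrib, ← Finset.mul_sum, ← Finset.mul_sum, Finset.sum_add_distrib,
      Finset.sum_const, nsmul_eq_mul, mul_comm ((G.cliqueTuples ι).card : ℝ)]
    gcongr
    exact hN v hv
  have hall : B.card * (W0 * (μ ^ 2 * (1 - 3 * θ) - 2 * μ * η * Fintype.card ι)) ≤
      s * (B.card * (Fintype.card ι * ((1 + θ) * W0)) +
        (Fintype.card ι : ℝ) ^ 2 * ((1 + θ) * W2 *
          (B.card * p ^ 3 * (Fintype.card V : ℝ) ^ 2 *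
            ((1 + τ) * (1 + δ - q) + 3 / (4 * τ * (B.card * p ^ 2)))))) +
      B.card * ((Fintype.card ι : ℝ) ^ 2 * ((Fintype.card ι : ℝ) ^ (s + 2) * ((1 + θ) *
        (c / p ^ ((s + 2) * (s + 2)) * W0)))) := by
    have h1 : B.card * (W0 * (μ ^ 2 * (1 - 3 * θ) - 2 * μ * η * Fintype.card ι)) ≤
        ∑ v ∈ B, ∑ x ∈ G.cliqueTuples ι, goodCount G G' L v x ^ 2 := by
      rw [← nsmul_eq_mul]
      exact Finset.card_nsmul_le_sum _ _ _ fun v _ => hsq v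
    refine h1.trans ((Finset.sum_le_sum hup).trans ?_)
    rw [Finset.sum_add_distrib, ← Finset.mul_sum, Finset.sum_add_distrib, Finset.sum_const,
      Finset.sum_const, nsmul_eq_mul, nsmul_eq_mul]
    gcongr
    refine hP.trans ?_
    gcongr
  -- Normalise per vertex of `B`, per clique tuple and per pair of indices, and by `p ^ 2`, the
  -- chance that both entries of a pair are joined to `v`.
  have hden : 0 < (B.card : ℝ) * W0 * (Fintype.card ι : ℝ) ^ 2 * p ^ 2 := by positivity
  refine le_of_mul_le_mul_left ?_ hden
  calc _ = B.card * (W0 * (μ ^ 2 * (1 - 3 * θ) - 2 * μ * η * Fintype.card ι)) := by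
        rw [hμ]; field_simp
    _ ≤ _ := hall
    _ = _ := by
        generalize (1 + τ) * (1 + δ - q) + 3 / (4 * τ * (B.card * p ^ 2)) = E
        rw [hWW]
        field_simp

end MainInequality

end SimpleGraph

/-! ### Choice of constants -/

namespace SimpleGraph

section Constants

open scoped Classical

/-- With `t = 1/r` one has `s t = 1 - 2 t`, so the main terms differ by `(1 - t)² - s t = t²`. The
errors add up to at most `5 r ξ`, whereas `t² = 20 r ξ`. -/
theorem averaged_inequality_false {s : ℕ} {r ξ p θ δ m E1 E2 η k : ℝ} (hr : r = s + 2)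
    (hξ : ξ = 1 / (20 * r ^ 3)) (hp0 : 0 < p) (hθ0 : 0 ≤ θ) (hθ : θ ≤ ξ)
    (hδ : δ ≤ ξ) (hη : η ≤ ξ * p / 2) (hE1 : E1 ≤ ξ) (hm0 : 0 < m) (hm : 2 / (p ^ 2 * ξ) ≤ m)
    (hk : 2 / ξ ^ 2 ≤ k) (hE2 : E2 = 3 / (4 * ξ * k))
    (h : (1 - 1 / r) ^ 2 * (1 - 3 * θ) - 2 * (1 - 1 / r) * η / p ≤
      s * ((1 + θ) / (m * p ^ 2) + (1 + θ) * ((1 + ξ) * (1 + δ - (1 - 1 / r)) + E2)) + E1) :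
    False := by
  have hs0 : (0 : ℝ) ≤ s := Nat.cast_nonneg _
  have hr2 : 2 ≤ r := by linarith
  have hr0 : 0 < r := by linarith
  have hξ0 : 0 < ξ := by rw [hξ]; positivity
  have hξr : ξ * (20 * r ^ 2) = 1 / r := by rw [hξ]; field_simp
  have hξ1 : ξ ≤ 1 / 160 := by
    rw [hξ]
    refine one_div_le_one_div_of_le (by norm_num) ?_
    have : (2 : ℝ) ^ 3 ≤ r ^ 3 := by gcongr
    linarith
  have hq1 : 1 / r ≤ 1 / 2 := one_div_le_one_div_of_le (by norm_num) hr2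
  have hq0 : 0 < 1 / r := by positivity
  set t := 1 / r with ht
  have hst : s * t = 1 - 2 * t := by
    rw [ht]; field_simp; linarith
  have hη' : 2 * (1 - t) * η / p ≤ ξ := by
    rw [div_le_iff₀ hp0]
    have h1 := mul_le_mul_of_nonneg_left hη (show 0 ≤ 2 * (1 - t) by linarith)
    have : 0 ≤ t * (ξ * p) := by positivity
    linarith
  have hθ' : (1 - t) ^ 2 * (3 * θ) ≤ 3 * ξ := by
    have : (1 - t) ^ 2 ≤ 1 := pow_le_one₀ (by linarith) (by linarith)
    calc (1 - t) ^ 2 * (3 * θ) ≤ 1 * (3 * θ) := by gcongr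
      _ ≤ _ := by linarith
  have hm' : (1 + θ) / (m * p ^ 2) ≤ ξ := by
    rw [div_le_iff₀ (by positivity)]
    rw [div_le_iff₀ (by positivity)] at hm
    linarith
  have hE2' : E2 ≤ 3 / 8 * ξ := by
    rw [hE2]
    rw [div_le_iff₀ (by positivity)] at hk
    have hk0 : 0 < k := by
      by_contra! hc
      nlinarith [sq_nonneg ξ]
    rw [div_le_iff₀ (by positivity)]
    linarith
  have hmid : (1 + θ) * ((1 + ξ) * (1 + δ - (1 - t)) + E2) ≤ t + 4 * ξ := by
    have h1 : (1 + ξ) * (1 + δ - (1 - t)) + E2 ≤ (1 + ξ) * (t + ξ) + 3 / 8 * ξ := by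
      have : 1 + δ - (1 - t) ≤ t + ξ := by linarith
      gcongr
    have h2 : 0 ≤ (1 + ξ) * (t + ξ) + 3 / 8 * ξ := by positivity
    have h3 := mul_le_mul_of_nonneg_left h1 (show 0 ≤ 1 + θ by linarith)
    have h4 := mul_le_mul_of_nonneg_right (show 1 + θ ≤ 1 + ξ by linarith) h2
    nlinarith
  have hsum := mul_le_mul_of_nonneg_left (add_le_add hm' hmid) hs0
  have hfin : (1 - t) ^ 2 ≤ s * t + 5 * s * ξ + 5 * ξ := by
    linarith
  rw [hst] at hfin
  have h1 : t ^ 2 ≤ 5 * (s + 1) * ξ := by linarith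
  have h2 : 5 * (s + 1) * ξ ≤ 5 * r * ξ := by rw [hr]; gcongr; linarith
  have h3 : ξ * (20 * r) = t ^ 2 := by
    rw [hξ, ht]; field_simp
  nlinarith

/-- Since `s + 1 = r - 1`, the main term is `(r - 1) m / r = m - m / r`. The spare `m / r ≥ 2 r`
covers the constant `r - 1`, and the `ξ` terms use at most a tenth of it. -/
theorem extension_threshold_aux {s : ℕ} {r ξ δ m : ℝ} (hr : r = s + 2)
    (hξ : ξ = 1 / (20 * r ^ 3)) (hδξ : δ ≤ ξ) (hm : 2 * r ^ 2 + 3 ≤ m) :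
    (s + 1) * (1 + (1 + δ - (1 - 1 / r) + ξ) * m) < m := by
  have hs0 : (0 : ℝ) ≤ s := Nat.cast_nonneg _
  have hr2 : 2 ≤ r := by linarith
  have hr0 : 0 < r := by linarith
  have hξ0 : 0 < ξ := by rw [hξ]; positivity
  have hm0 : 0 < m := by nlinarith
  have hq1 : 1 / r ≤ 1 / 2 := one_div_le_one_div_of_le (by norm_num) hr2
  have h1 : (1 + δ - (1 - 1 / r) + ξ) * m ≤ (1 / r + 2 * ξ) * m :=
    mul_le_mul_of_nonneg_right (by linarith) hm0.le
  have h2 : (s + 1) * (1 + (1 + δ - (1 - 1 / r) + ξ) * m) ≤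
      (r - 1) * (1 + (1 / r + 2 * ξ) * m) := by
    have : (s : ℝ) + 1 = r - 1 := by linarith
    rw [this]
    exact mul_le_mul_of_nonneg_left (by linarith) (by linarith)
  have h3 : (r - 1) * (1 + (1 / r + 2 * ξ) * m) = r - 1 + m - m / r + (r - 1) * (2 * ξ * m) := by
    field_simp; ring
  have h4 : (r - 1) * (2 * ξ * m) ≤ m / r / 10 := by
    have e1 : (r - 1) * (2 * ξ * m) ≤ r * (2 * ξ * m) :=
      mul_le_mul_of_nonneg_right (by linarith) (by positivity)
    have e2 : r * (2 * ξ * m) = m / r / 10 * (1 / r) := by rw [hξ]; field_simp; norm_num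
    have e3 : m / r / 10 * (1 / r) ≤ m / r / 10 * 1 :=
      mul_le_mul_of_nonneg_left (by linarith) (by positivity)
    linarith
  have h5 : 2 * r ≤ m / r := by rw [le_div_iff₀ hr0]; nlinarith
  linarith

/-- In a subgraph of relative minimum degree `1 - 1 / (s + 2)` of a quasirandom graph, all but
`O(p⁻²)` vertices are the root of a positive proportion of all potential `(s + 2)`-cliques. -/
theorem exists_card_few_rooted_le (s : ℕ) : ∃ C : ℝ, 0 < C ∧ ∀ p : ℝ, 0 < p → p ≤ 1 →
    ∃ (c δ : ℝ) (m N : ℕ), 0 < c ∧ 0 < δ ∧ ∀ (V : Type) [Fintype V] (G G' : SimpleGraph V),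
      N ≤ Fintype.card V → G.JointNbhdsRegular p δ m → G' ≤ G →
      (∀ u, (1 - 1 / ((s + 2 : ℕ) : ℝ)) * (p * Fintype.card V) ≤ ∑ b, G'.adjInd u b) →
      ((Finset.univ.filter fun v => ((G'.rootedCliqueTuples v (s + 1)).card : ℝ) <
        c * (Fintype.card V : ℝ) ^ (s + 2)).card : ℝ) ≤ C / p ^ 2 := by
  obtain ⟨r, hr⟩ : ∃ r : ℝ, r = s + 2 := ⟨_, rfl⟩
  have hs0 : (0 : ℝ) ≤ s := Nat.cast_nonneg _
  have hr2 : 2 ≤ r := by linarith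
  have hr0 : 0 < r := by linarith
  obtain ⟨ξ, hξ⟩ : ∃ ξ : ℝ, ξ = 1 / (20 * r ^ 3) := ⟨_, rfl⟩
  have hξ0 : 0 < ξ := by rw [hξ]; positivity
  have hξ1 : ξ ≤ 1 / 160 := by
    rw [hξ]
    refine one_div_le_one_div_of_le (by norm_num) ?_
    have : (2 : ℝ) ^ 3 ≤ r ^ 3 := by gcongr
    linarith
  refine ⟨2 / ξ ^ 2, by positivity, fun p hp0 hp1 => ?_⟩
  obtain ⟨C, hC⟩ : ∃ C : ℝ, C = 2 / ξ ^ 2 := ⟨_, rfl⟩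
  have hC0 : 0 < C := by rw [hC]; positivity
  rw [← hC]
  -- The summands serve, in order, the variance error `4 / m`, the diagonal error `(1 + θ) / (m p ^
  -- 2)`, and the extension threshold. With `θ` and `β` below, the three terms `4 θ`, `4 / m`, `4 β
  -- / p ^ 3` are each at most `ξ ^ 3 p / 6`, so their sum over `γ ^ 2 = ξ ^ 2` is at most `ξ p /
  -- 2`.
  obtain ⟨m, hm⟩ := exists_nat_ge (24 / (ξ ^ 3 * p) + 2 / (p ^ 2 * ξ) + 2 * r ^ 2 + 3)
  have hm1 : 24 / (ξ ^ 3 * p) ≤ m := by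
    have : 0 ≤ 2 / (p ^ 2 * ξ) := by positivity
    nlinarith
  have hm2 : 2 / (p ^ 2 * ξ) ≤ m := by
    have : 0 ≤ 24 / (ξ ^ 3 * p) := by positivity
    nlinarith
  have hm3 : 2 * r ^ 2 + 3 ≤ m := by
    have : 0 ≤ 24 / (ξ ^ 3 * p) := by positivity
    have : 0 ≤ 2 / (p ^ 2 * ξ) := by positivity
    linarith
  have hm3' : 3 ≤ m := by
    have : (3 : ℝ) ≤ m := by nlinarith
    exact_mod_cast this
  have hms : s + 2 ≤ m := by
    have : ((s + 2 : ℕ) : ℝ) ≤ m := by push_cast; nlinarith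
    exact_mod_cast this
  have hm0 : (0 : ℝ) < m := by nlinarith
  obtain ⟨θ, hθ⟩ : ∃ θ : ℝ, θ = ξ ^ 3 * p / 24 := ⟨_, rfl⟩
  obtain ⟨β, hβ⟩ : ∃ β : ℝ, β = ξ ^ 3 * p ^ 4 / 24 := ⟨_, rfl⟩
  have hθ0 : 0 < θ := by rw [hθ]; positivity
  have hβ0 : 0 < β := by rw [hβ]; positivity
  have hθξ : θ ≤ ξ := by
    have h1 : ξ ^ 3 * p ≤ ξ ^ 3 * 1 := by gcongr
    have h2 : ξ ^ 3 ≤ ξ := pow_le_of_le_one hξ0.le (by linarith) (by norm_num)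
    rw [hθ]; linarith
  -- Chosen so that the rooted-clique term of `averaged_inequality` becomes `(1 + θ) / 2 * ξ`.
  obtain ⟨c, hc⟩ : ∃ c : ℝ, c = ξ * p ^ ((s + 2) * (s + 2)) * p ^ 2 / (2 * (m : ℝ) ^ (s + 2)) :=
    ⟨_, rfl⟩
  have hc0 : 0 < c := by rw [hc]; positivity
  obtain ⟨δ, hδ0, hδξ, hδC, hδβ, hδ1, hδ2⟩ : ∃ δ : ℝ, 0 < δ ∧ δ ≤ ξ ∧ 7 * δ * (C + 1) ≤ 1 ∧
      3 * δ ≤ 2 * β ^ 2 ∧ 1 - θ ≤ (1 - δ) ^ m ∧ (1 + δ) ^ m ≤ 1 + θ := by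
    have hev : ∀ f : ℝ → ℝ, Continuous f → ∀ a, f 0 < a → ∀ᶠ x in 𝓝[>] (0 : ℝ), f x ≤ a :=
      fun f hf a ha => ((hf.tendsto 0).mono_left nhdsWithin_le_nhds).eventually_le_const ha
    have e1 := hev (fun x => x) continuous_id ξ hξ0
    have e2 := hev (fun x => 7 * x * (C + 1)) (by fun_prop) 1 (by norm_num)
    have e3 := hev (fun x => 3 * x) (by fun_prop) (2 * β ^ 2) (by rw [mul_zero]; positivity)
    have e4 := hev (fun x => -(1 - x) ^ m) (by fun_prop) (-(1 - θ)) (by simpa using hθ0)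
    have e5 := hev (fun x => (1 + x) ^ m) (by fun_prop) (1 + θ) (by simpa using hθ0)
    obtain ⟨x, h1, h2, h3, h4, h5, h0⟩ :=
      (e1.and (e2.and (e3.and (e4.and (e5.and self_mem_nhdsWithin))))).exists
    exact ⟨x, h0, h1, h2, h3, neg_le_neg_iff.1 h4, h5⟩
  obtain ⟨N, hN⟩ := exists_nat_ge (1 / (2 * β ^ 2) + 1)
  refine ⟨c, δ, m, N, hc0, hδ0, fun V _ G G' hNV hG hG' hdeg => ?_⟩
  by_contra! hcon
  have hnn : 1 / (2 * β ^ 2) + 1 ≤ (Fintype.card V : ℝ) := hN.trans (Nat.cast_le.2 hNV)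
  have hβ2 : 0 ≤ 1 / (2 * β ^ 2) := by positivity
  have hn0 : 0 < Fintype.card V := by
    have : (0 : ℝ) < Fintype.card V := by linarith
    exact_mod_cast this
  have : Nonempty V := Fintype.card_pos_iff.1 hn0
  have hnβ : 1 ≤ 2 * β ^ 2 * Fintype.card V := by
    have h1 : 1 / (2 * β ^ 2) ≤ Fintype.card V := by linarith
    rw [div_le_iff₀ (by positivity)] at h1
    linarith
  -- Exactly `⌊C / p ^ 2⌋ + 1` poor vertices are kept, so that `C ≤ |B| p ^ 2 ≤ C + 1`. The lower
  -- bound makes codegrees concentrate; the upper bound lets `δ` be fixed before `B`.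
  obtain ⟨B, hBsub, hBcard⟩ := Finset.exists_subset_card_eq
    (Nat.succ_le_of_lt ((Nat.floor_lt (by positivity)).2 hcon))
  have hkC : C ≤ B.card * p ^ 2 := by
    have := Nat.lt_floor_add_one (C / p ^ 2)
    rw [div_lt_iff₀ (by positivity)] at this
    rw [hBcard]; push_cast; exact this.le
  have hkC' : B.card * p ^ 2 ≤ C + 1 := by
    have h1 := Nat.floor_le (show 0 ≤ C / p ^ 2 by positivity)
    rw [le_div_iff₀ (by positivity)] at h1
    have h2 : p ^ 2 ≤ 1 := pow_le_one₀ hp0.le hp1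
    rw [hBcard]; push_cast; linarith
  have hrcast : ((s + 2 : ℕ) : ℝ) = r := by rw [hr]; push_cast; ring
  rw [hrcast] at hdeg
  have hq1 : 1 / r ≤ 1 / 2 := one_div_le_one_div_of_le (by norm_num) hr2
  have hG0 : G.JointNbhdsRegular p δ (Fintype.card (Fin m)) := by simpa using hG
  have hmarg : G.HasRegularMarginals (Fin m) p θ :=
    hG0.hasRegularMarginals hp0.le hδ0.le (by linarith) (by simpa using hδ1) (by simpa using hδ2)
  have hL := extension_threshold_aux hr hξ hδξ hm3
  have hB0 : B.Nonempty := Finset.card_pos.1 (by omega)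
  have hB1 : 7 * δ * (B.card * p ^ 2) ≤ 1 :=
    (mul_le_mul_of_nonneg_left hkC' (by positivity)).trans hδC
  have hmain := averaged_inequality hG0 hmarg hG' hp0 hp1 (s := s) (by simpa using hms)
    (by simpa using hm3') hδ0.le (by linarith) hθ0.le (by linarith) hn0 hβ0
    (by nlinarith) (q := 1 - 1 / r) (by linarith) hdeg (γ := ξ) hξ0
    (by simpa using hL) (τ := ξ) hξ0 hB0 hB1 (c := c)
    (fun v hv => (Finset.mem_filter.1 (hBsub hv)).2.le)
  rw [Fintype.card_fin] at hmain
  refine averaged_inequality_false hr hξ hp0 hθ0.le hθξ hδξ ?_ ?_ hm0 hm2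
    (hC ▸ hkC) rfl hmain
  · rw [div_le_iff₀ (by positivity)]
    have h1 : 4 * θ = ξ ^ 3 * p / 6 := by rw [hθ]; ring
    have h2 : 4 * β / p ^ 3 = ξ ^ 3 * p / 6 := by rw [hβ]; field_simp; norm_num
    have h3 : 4 / (m : ℝ) ≤ ξ ^ 3 * p / 6 := by
      rw [div_le_iff₀ (by positivity)] at hm1
      rw [div_le_iff₀ hm0]
      linarith
    rw [h1, h2]
    linarith
  · have h1 : (1 + θ) * (m : ℝ) ^ (s + 2) * c / p ^ ((s + 2) * (s + 2)) / p ^ 2 =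
        (1 + θ) / 2 * ξ := by
      rw [hc]; field_simp
    rw [h1]
    have : (1 + θ) / 2 ≤ 1 := by linarith
    exact mul_le_of_le_one_left hξ0.le this

end Constants

end SimpleGraph

/-! ### Supersaturation: complete partite blow-ups of dense families -/

section Blowup

open scoped Classical

variable {V : Type*} [Fintype V]

theorem card_not_injective_le (h : ℕ) :
    (Finset.univ.filter fun z : Fin (h + 1) → V => ¬ Function.Injective z).card ≤
      (h + 1) ^ 2 * Fintype.card V ^ h := by
  have hsub : (Finset.univ.filter fun z : Fin (h + 1) → V => ¬ Function.Injective z) ⊆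
      Finset.univ.biUnion fun e : Fin (h + 1) × Fin (h + 1) =>
        Finset.univ.filter fun z => e.1 ≠ e.2 ∧ z e.1 = z e.2 := by
    intro z hz
    simp only [Finset.mem_filter, Finset.mem_univ, true_and, Function.Injective, not_forall] at hz
    obtain ⟨a, b, hab, hne⟩ := hz
    exact Finset.mem_biUnion.2 ⟨(a, b), Finset.mem_univ _,
      Finset.mem_filter.2 ⟨Finset.mem_univ _, hne, hab⟩⟩
  refine (Finset.card_le_card hsub).trans ((Finset.card_biUnion_le_card_mul _ _
    (Fintype.card V ^ h) ?_).trans_eq (by simp [sq]))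
  rintro ⟨a, b⟩ _
  calc _ ≤ (Finset.univ : Finset (Fin h → V)).card := by
        refine Finset.card_le_card_of_injOn (fun z => z ∘ b.succAbove)
          (fun _ _ => Finset.mem_coe.2 (Finset.mem_univ _)) ?_
        intro z hz w hw hzw
        simp only [Finset.coe_filter, Finset.mem_univ, true_and, Set.mem_ofPred_eq] at hz hw
        obtain ⟨a', rfl⟩ := Fin.exists_succAbove_eq hz.1
        have hpt : ∀ i, z (b.succAbove i) = w (b.succAbove i) := fun i => congrFun hzw i
        funext i
        rcases eq_or_ne i b with rfl | hi
        · rw [← hz.2, ← hw.2, hpt]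
        · obtain ⟨i', rfl⟩ := Fin.exists_succAbove_eq hi
          exact hpt i'
    _ = _ := by simp

/-- The sum equals `∑ y, |D y| ^ (h + 1)`, where `D y` is the set of first entries completing `y`;
the power mean inequality bounds it below. -/
theorem sum_card_common_fiber (r h : ℕ) (F : Finset (Fin (r + 1) → V)) {c : ℝ} (hc : 0 ≤ c)
    (hn : 0 < Fintype.card V) (hF : c * (Fintype.card V : ℝ) ^ (r + 1) ≤ F.card) :
    c ^ (h + 1) * (Fintype.card V : ℝ) ^ (r + (h + 1)) ≤ ∑ z : Fin (h + 1) → V,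
      ((Finset.univ.filter fun y : Fin r → V =>
        ∀ t, (Fin.cons (z t) y : Fin (r + 1) → V) ∈ F).card : ℝ) := by
  set D : (Fin r → V) → Finset V := fun y =>
    Finset.univ.filter fun a => (Fin.cons a y : Fin (r + 1) → V) ∈ F with hD
  have h1 : ∑ y, ((D y).card : ℝ) = F.card := by
    have : (F.card : ℝ) = ∑ x : Fin (r + 1) → V, if x ∈ F then (1 : ℝ) else 0 := by simp
    rw [this, SimpleGraph.sum_fin_succ_arrow, Finset.sum_comm]
    refine Finset.sum_congr rfl fun y _ => ?_
    rw [hD, Finset.card_filter, Nat.cast_sum]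
    simp
  have h2 : ∑ z : Fin (h + 1) → V, ((Finset.univ.filter fun y : Fin r → V =>
        ∀ t, (Fin.cons (z t) y : Fin (r + 1) → V) ∈ F).card : ℝ) =
      ∑ y, ((D y).card : ℝ) ^ (h + 1) := by
    simp only [Finset.card_filter, Nat.cast_sum]
    rw [Finset.sum_comm]
    refine Finset.sum_congr rfl fun y _ => ?_
    have : (Fintype.piFinset fun _ : Fin (h + 1) => D y).card = (D y).card ^ (h + 1) := by
      simp
    rw [← Nat.cast_pow, ← this, ← Nat.cast_sum, ← Finset.card_filter]
    congr 2
    ext z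
    simp [hD]
  rw [h2]
  refine le_trans ?_ (pow_sum_div_card_le_sum_pow (fun y _ => Nat.cast_nonneg _) h)
  have hn' : (0 : ℝ) < Fintype.card V := Nat.cast_pos.2 hn
  rw [h1, Finset.card_univ, Fintype.card_fun, Fintype.card_fin, le_div_iff₀ (by positivity)]
  push_cast
  calc _ = (c * (Fintype.card V : ℝ) ^ (r + 1)) ^ (h + 1) := by ring
    _ ≤ _ := by gcongr

/-- A dense `r`-partite `r`-uniform hypergraph contains a large complete `r`-partite
hypergraph (Erdős). -/
theorem exists_blowup_of_dense (h r : ℕ) : ∀ c : ℝ, 0 < c → ∃ N : ℕ, ∀ (V : Type) [Fintype V],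
    N ≤ Fintype.card V → ∀ F : Finset (Fin r → V), c * (Fintype.card V : ℝ) ^ r ≤ F.card →
      ∃ e : Fin r → Fin (h + 1) → V, (∀ i, Function.Injective (e i)) ∧
        ∀ j : Fin r → Fin (h + 1), (fun i => e i (j i)) ∈ F := by
  induction r with
  | zero =>
    intro c hc
    refine ⟨0, fun V _ _ F hF => ⟨fun i => i.elim0, fun i => i.elim0, fun j => ?_⟩⟩
    have : 0 < F.card := by
      have : (0 : ℝ) < F.card := by
        refine lt_of_lt_of_le ?_ hF
        simpa using hc
      exact_mod_cast this
    obtain ⟨x, hx⟩ := Finset.card_pos.1 this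
    convert hx
  | succ r ih =>
    intro c hc
    obtain ⟨N, hN⟩ := ih (c ^ (h + 1) / 2) (by positivity)
    obtain ⟨N', hN'⟩ := exists_nat_ge (2 * (h + 1) ^ 2 / c ^ (h + 1))
    refine ⟨max N N' + 1, fun V _ hV F hF => ?_⟩
    have hn : 0 < Fintype.card V := by omega
    have hn' : (0 : ℝ) < Fintype.card V := Nat.cast_pos.2 hn
    have hnN' : 2 * (h + 1) ^ 2 / c ^ (h + 1) < (Fintype.card V : ℝ) :=
      hN'.trans_lt (Nat.cast_lt.2 (by omega))
    rw [div_lt_iff₀ (by positivity)] at hnN'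
    set Fz : (Fin (h + 1) → V) → Finset (Fin r → V) := fun z => Finset.univ.filter fun y =>
      ∀ t, (Fin.cons (z t) y : Fin (r + 1) → V) ∈ F with hFz
    -- Average over the choices `z` of the first part. Non-injective `z` number only `O(n ^ h)`, so
    -- for large `n` they carry less than half of the total, and some injective `z` keeps density `c
    -- ^ (h + 1) / 2`.
    obtain ⟨z, hz, hzF⟩ : ∃ z : Fin (h + 1) → V, Function.Injective z ∧
        c ^ (h + 1) / 2 * (Fintype.card V : ℝ) ^ r ≤ (Fz z).card := by
      by_contra! hcon
      have h1 := sum_card_common_fiber r h F hc.le hn hF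
      have h2 : ∀ z ∈ (Finset.univ : Finset (Fin (h + 1) → V)), ((Fz z).card : ℝ) ≤
          c ^ (h + 1) / 2 * (Fintype.card V : ℝ) ^ r +
            if ¬ Function.Injective z then (Fintype.card V : ℝ) ^ r else 0 := by
        intro z _
        by_cases hz : Function.Injective z
        · rw [if_neg (not_not.2 hz), add_zero]
          exact (hcon z hz).le
        · rw [if_pos hz]
          have : ((Fz z).card : ℝ) ≤ (Fintype.card V : ℝ) ^ r := by
            have := (Fz z).card_le_univ
            rw [Fintype.card_fun, Fintype.card_fin] at this
            exact_mod_cast this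
          exact this.trans (le_add_of_nonneg_left (by positivity))
      have h3 := h1.trans (Finset.sum_le_sum h2)
      rw [Finset.sum_add_distrib, Finset.sum_const, Finset.card_univ, Fintype.card_fun,
        Fintype.card_fin, nsmul_eq_mul, ← Finset.sum_filter, Finset.sum_const, nsmul_eq_mul] at h3
      have h4 := Nat.cast_le (α := ℝ).2 (card_not_injective_le (V := V) h)
      push_cast at h3 h4
      have h5 : ((Finset.univ.filter fun z : Fin (h + 1) → V => ¬ Function.Injective z).card : ℝ) *
          (Fintype.card V : ℝ) ^ r ≤ (h + 1) ^ 2 * (Fintype.card V : ℝ) ^ h *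
            (Fintype.card V : ℝ) ^ r := by gcongr
      have h6 : (0 : ℝ) < (Fintype.card V : ℝ) ^ h * (Fintype.card V : ℝ) ^ r := by positivity
      have h7 := mul_lt_mul_of_pos_right hnN' h6
      have e1 : c ^ (h + 1) * (Fintype.card V : ℝ) ^ (r + (h + 1)) =
        Fintype.card V * c ^ (h + 1) * ((Fintype.card V : ℝ) ^ h * (Fintype.card V : ℝ) ^ r) := by
        ring
      have e2 : (Fintype.card V : ℝ) ^ (h + 1) * (c ^ (h + 1) / 2 * (Fintype.card V : ℝ) ^ r) =
        Fintype.card V * c ^ (h + 1) * ((Fintype.card V : ℝ) ^ h * (Fintype.card V : ℝ) ^ r) / 2 := by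
        ring
      rw [e1, e2] at h3
      linarith
    obtain ⟨e, he, heF⟩ := hN V (by omega) (Fz z) hzF
    refine ⟨Fin.cons z e, fun i => ?_, fun j => ?_⟩
    · refine Fin.cases ?_ (fun i => ?_) i
      · simpa using hz
      · simpa using he i
    · have := (Finset.mem_filter.1 (heF fun i => j i.succ)).2 (j 0)
      convert this using 1
      funext i
      refine Fin.cases ?_ (fun i => ?_) i <;> simp

/-- A tuple meeting `T` does so in one of `k + 1` coordinates, with the other `k` coordinates free.
-/
theorem card_filter_avoiding_le (k : ℕ) (F : Finset (Fin (k + 1) → V)) (T : Finset V) :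
    (F.card : ℝ) - (k + 1) * (T.card * (Fintype.card V : ℝ) ^ k) ≤
      ((F.filter fun y => ∀ i, y i ∉ T).card : ℝ) := by
  have h1 := Finset.card_filter_add_card_filter_not (s := F) (fun y => ∀ i, y i ∉ T)
  have h2 : (F.filter fun y => ¬ ∀ i, y i ∉ T).card ≤ (k + 1) * (T.card * Fintype.card V ^ k) := by
    have hsub : (F.filter fun y => ¬ ∀ i, y i ∉ T) ⊆ Finset.univ.biUnion fun i : Fin (k + 1) =>
        Fintype.piFinset (Function.update (fun _ => Finset.univ) i T) := by
      intro y hy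
      simp only [Finset.mem_filter, not_forall, not_not] at hy
      obtain ⟨_, i, hi⟩ := hy
      refine Finset.mem_biUnion.2 ⟨i, Finset.mem_univ _, Fintype.mem_piFinset.2 fun j => ?_⟩
      rcases eq_or_ne j i with rfl | hj
      · simpa using hi
      · simp [hj]
    refine (Finset.card_le_card hsub).trans ((Finset.card_biUnion_le_card_mul _ _
      (T.card * Fintype.card V ^ k) fun i _ => ?_).trans_eq (by simp))
    rw [Fintype.card_piFinset, ← Finset.mul_prod_erase _ _ (Finset.mem_univ i),
      Finset.prod_congr rfl (g := fun _ => Fintype.card V)]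
    · simp
    · intro j hj
      simp [Finset.ne_of_mem_erase hj]
  have h3 := Nat.cast_le (α := ℝ).2 h2
  have h4 : (F.card : ℝ) = ((F.filter fun y => ∀ i, y i ∉ T).card : ℝ) +
      ((F.filter fun y => ¬ ∀ i, y i ∉ T).card : ℝ) := by exact_mod_cast h1.symm
  push_cast at h3
  linarith

end Blowup

/-! ### Embedding the fixed graph at a rich vertex -/

namespace SimpleGraph

section Embedding

open scoped Classical

/-- Permute colours so that a chosen vertex `w₀` has the last colour and send `w₀` to `v`; every
other vertex goes to the part of its colour. Neighbours of `w₀` have other colours, so they land in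
parts joined to `v`. -/
theorem InCopyAvoiding.of_blowup {V W : Type*} [Fintype V] [Finite W] [Nonempty W]
    {H : SimpleGraph W} {G : SimpleGraph V} {k h : ℕ} (hH : H.Colorable (k + 1))
    (hh : Nat.card W ≤ h + 1) {T : Set V} {v : V} (hv : v ∉ T)
    (e : Fin (k + 1) → Fin (h + 1) → V) (he : ∀ i, Function.Injective (e i))
    (hF : ∀ j : Fin (k + 1) → Fin (h + 1), (fun i => e i (j i)) ∈ G.rootedCliqueTuples v k)
    (hT : ∀ i a, e i a ∉ T ∧ e i a ≠ v) :
    H.InCopyAvoiding G T v := by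
  obtain ⟨w₀⟩ := ‹Nonempty W›
  obtain ⟨κ₀⟩ := hH
  let κ : H.Coloring (Fin (k + 1)) := Coloring.mk
    (fun w => Equiv.swap (κ₀ w₀) (Fin.last k) (κ₀ w)) fun {a b} hab hne =>
      κ₀.valid hab ((Equiv.swap _ _).injective hne)
  have hκ : κ w₀ = Fin.last k := Equiv.swap_apply_left _ _
  obtain ⟨idx⟩ : Nonempty (W ↪ Fin (h + 1)) := by
    cases nonempty_fintype W
    rw [Nat.card_eq_fintype_card] at hh
    exact Function.Embedding.nonempty_of_card_le (by simpa using hh)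
  have hadj : ∀ i j a b, i ≠ j → G.Adj (e i a) (e j b) := by
    intro i j a b hij
    have := (Finset.mem_filter.1 (hF fun l => if l = i then a else b)).1
    simpa [hij.symm] using mem_cliqueTuples.1 this i j hij
  have hroot : ∀ i a, i ≠ Fin.last k → G.Adj v (e i a) := by
    intro i a hi
    obtain ⟨i, rfl⟩ := Fin.exists_castSucc_eq.2 hi
    exact (Finset.mem_filter.1 (hF fun _ => a)).2 i
  let φ : W → V := fun w => if w = w₀ then v else e (κ w) (idx w)
  have hφ₀ : φ w₀ = v := if_pos rfl
  have hφ : ∀ w, w ≠ w₀ → φ w = e (κ w) (idx w) := fun w hw => if_neg hw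
  have hhom : ∀ {a b}, H.Adj a b → G.Adj (φ a) (φ b) := by
    intro a b hab
    by_cases ha : a = w₀
    · subst ha
      rw [hφ₀, hφ b hab.ne']
      exact hroot _ _ fun hb => κ.valid hab (hκ.trans hb.symm)
    · by_cases hb : b = w₀
      · subst hb
        rw [hφ₀, hφ a ha]
        exact (hroot _ _ fun ha' => κ.valid hab (ha'.trans hκ.symm)).symm
      · rw [hφ a ha, hφ b hb]
        exact hadj _ _ _ _ (κ.valid hab)
  have hinj : Function.Injective φ := by
    intro a b hab
    by_cases ha : a = w₀
    · by_cases hb : b = w₀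
      · rw [ha, hb]
      · rw [ha, hφ₀, hφ b hb] at hab
        exact absurd hab.symm (hT _ _).2
    · by_cases hb : b = w₀
      · rw [hb, hφ₀, hφ a ha] at hab
        exact absurd hab (hT _ _).2
      · rw [hφ a ha, hφ b hb] at hab
        by_cases hc : κ a = κ b
        · rw [hc] at hab
          exact idx.injective (he _ hab)
        · exact absurd hab (hadj _ _ _ _ hc).ne
  refine ⟨⟨⟨φ, hhom⟩, hinj⟩, ⟨w₀, hφ₀⟩, ?_⟩
  rw [Set.disjoint_left]
  rintro _ ⟨w, rfl⟩
  change φ w ∉ T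
  by_cases hw : w = w₀
  · rw [hw, hφ₀]; exact hv
  · rw [hφ w hw]; exact (hT _ _).1

/-- A root of a positive proportion of all potential cliques lies in a copy of `H` avoiding any
given small set. -/
theorem exists_inCopyAvoiding_of_rooted (k h : ℕ) {c : ℝ} (hc : 0 < c) :
    ∃ N : ℕ, ∀ (V : Type) [Fintype V], N ≤ Fintype.card V → ∀ (G : SimpleGraph V) (v : V),
      c * (Fintype.card V : ℝ) ^ (k + 1) ≤ (G.rootedCliqueTuples v k).card →
      ∀ T : Finset V, v ∉ T → (T.card : ℝ) ≤ c / (4 * (k + 1)) * Fintype.card V →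
      ∀ (W : Type*) [Finite W] [Nonempty W] (H : SimpleGraph W), H.Colorable (k + 1) →
        Nat.card W ≤ h + 1 → H.InCopyAvoiding G (T : Set V) v := by
  obtain ⟨N, hN⟩ := exists_blowup_of_dense h (k + 1) (c / 2) (by positivity)
  obtain ⟨N', hN'⟩ := exists_nat_ge (4 * (k + 1) / c)
  refine ⟨max N N', fun V _ hV G v hv T hvT hT W _ _ H hH hW => ?_⟩
  have hn : 4 * (k + 1) / c ≤ (Fintype.card V : ℝ) :=
    hN'.trans (Nat.cast_le.2 ((le_max_right _ _).trans hV))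
  have hcount := card_filter_avoiding_le k (G.rootedCliqueTuples v k) (insert v T)
  -- The root must be avoided as well. For `n ≥ 4 (k + 1) / c` this one vertex costs no more than
  -- the allowance for `T`, and removing both destroys at most half of the rooted cliques.
  have hT' : ((insert v T).card : ℝ) ≤ c / (2 * (k + 1)) * Fintype.card V := by
    rw [Finset.card_insert_of_notMem hvT]
    push_cast
    have h1 : 1 ≤ c / (4 * (k + 1)) * Fintype.card V := by
      rw [div_mul_eq_mul_div, le_div_iff₀ (by positivity)]
      rw [div_le_iff₀ hc] at hn
      linarith
    have h2 : c / (2 * (k + 1)) = c / (4 * (k + 1)) + c / (4 * ((k : ℝ) + 1)) := by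
      field_simp; norm_num
    rw [h2, add_mul]
    linarith
  have hdense : c / 2 * (Fintype.card V : ℝ) ^ (k + 1) ≤
      (((G.rootedCliqueTuples v k).filter fun y => ∀ i, y i ∉ insert v T).card : ℝ) := by
    refine le_trans ?_ hcount
    have h1 : (k + 1) * (((insert v T).card : ℝ) * (Fintype.card V : ℝ) ^ k) ≤
        (k + 1) * (c / (2 * (k + 1)) * Fintype.card V * (Fintype.card V : ℝ) ^ k) := by gcongr
    have h2 : (k + 1) * (c / (2 * (k + 1)) * Fintype.card V * (Fintype.card V : ℝ) ^ k) =
        c / 2 * (Fintype.card V : ℝ) ^ (k + 1) := by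
      field_simp; ring
    linarith
  obtain ⟨e, he, heF⟩ := hN V ((le_max_left _ _).trans hV) _ hdense
  refine InCopyAvoiding.of_blowup hH hW (by simpa using hvT) e he
    (fun j => (Finset.mem_filter.1 (heF j)).1) fun i a => ?_
  have := (Finset.mem_filter.1 (heF fun _ => a)).2 i
  simp only [Finset.mem_insert, not_or] at this
  exact ⟨by simpa using this.2, this.1⟩

/-- The number of exceptional vertices, uniformly in the chromatic number. -/
theorem exists_card_few_rooted_le' (k : ℕ) : ∃ C : ℝ, 0 < C ∧ ∀ p : ℝ, 0 < p → p ≤ 1 →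
    ∃ (c δ : ℝ) (m N : ℕ), 0 < c ∧ 0 < δ ∧ ∀ (V : Type) [Fintype V] (G G' : SimpleGraph V),
      N ≤ Fintype.card V → G.JointNbhdsRegular p δ m → G' ≤ G →
      (∀ u, (1 - 1 / ((k + 1 : ℕ) : ℝ)) * (p * Fintype.card V) ≤ ∑ b, G'.adjInd u b) →
      ((Finset.univ.filter fun v => ((G'.rootedCliqueTuples v k).card : ℝ) <
        c * (Fintype.card V : ℝ) ^ (k + 1)).card : ℝ) ≤ C / p ^ 2 := by
  rcases k with _ | s
  -- For one colour every single vertex is a rooted clique, so there are `n` of them and no vertex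
  -- is poor.
  · refine ⟨1, one_pos, fun p hp _ => ⟨1, 1, 0, 0, one_pos, one_pos, fun V _ G G' _ _ _ _ => ?_⟩⟩
    have h1 : ∀ v, G'.rootedCliqueTuples v 0 = Finset.univ := fun v => by
      refine Finset.eq_univ_of_forall fun y => Finset.mem_filter.2
        ⟨mem_cliqueTuples.2 fun i j hij => absurd (Fin.ext (by omega)) hij, fun i => i.elim0⟩
    simp [h1]
    positivity
  · exact exists_card_few_rooted_le s

end Embedding

end SimpleGraph

/-! ### Assembly -/

open SimpleGraph in
theorem mainTheorem7 (r : ℕ) (hr : 1 ≤ r) :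
    ∃ C : ℝ, 0 < C ∧ ∀ p : unitInterval, 0 < p → ∃ ε : ℝ, 0 < ε ∧
      ∀ (W : Type*) [Finite W] (H₀ : SimpleGraph W), H₀.chromaticNumber = (r : ℕ∞) →
        AsymptoticallyAlmostSurely p fun n G =>
          ∀ (G' : SimpleGraph (Fin n)) [DecidableRel G'.Adj], G' ≤ G →
            (1 - 1 / (r : ℝ)) * n * (p : ℝ) ≤ (G'.minDegree : ℝ) →
              ∀ T : Finset (Fin n), (T.card : ℝ) ≤ ε * n →
                (({v : Fin n | v ∉ T ∧ ¬ H₀.InCopyAvoiding G' (T : Set (Fin n)) v}.ncard : ℕ) : ℝ)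
                  ≤ C / (p : ℝ) ^ 2 := by
  obtain ⟨k, rfl⟩ : ∃ k, r = k + 1 := ⟨r - 1, by omega⟩
  obtain ⟨C, hC, hmain⟩ := exists_card_few_rooted_le' k
  refine ⟨C, hC, fun p hp => ?_⟩
  obtain ⟨c, δ, m, N, hc, hδ, hfew⟩ := hmain p hp p.2.2
  refine ⟨c / (4 * (k + 1)), by positivity, fun W _ H₀ hχ => ?_⟩
  have hcol : H₀.Colorable (k + 1) := chromaticNumber_le_iff_colorable.1 hχ.le
  have hne : Nonempty W := by
    by_contra hempty
    rw [not_nonempty_iff] at hempty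
    rw [chromaticNumber_eq_zero_of_isEmpty] at hχ
    exact absurd hχ.symm (by simp)
  -- Only the threshold `N'` depends on `H₀`, through its number of vertices; `ε` has already been
  -- fixed.
  obtain ⟨N', hN'⟩ := exists_inCopyAvoiding_of_rooted k (Nat.card W) hc
  refine tendsto_of_tendsto_of_tendsto_of_le_of_le'
    (asymptoticallyAlmostSurely_jointNbhdsRegular hp hδ m) tendsto_const_nhds ?_
    (Eventually.of_forall fun n => MeasureTheory.prob_le_one)
  filter_upwards [eventually_ge_atTop (max N N')] with n hn
  -- For large `n` regularity of `G` implies the property for all `G'` and `T` at once, so no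
  -- further probability is spent on these choices.
  refine MeasureTheory.measure_mono fun G hG G' _ hG' hdeg T hT => ?_
  have hdeg' : ∀ u, (1 - 1 / ((k + 1 : ℕ) : ℝ)) * (p * Fintype.card (Fin n)) ≤
      ∑ b, G'.adjInd u b := by
    intro u
    have h1 : ∑ b, G'.adjInd u b = G'.degree u := by
      rw [← card_neighborFinset_eq_degree, neighborFinset_eq_filter, Finset.card_filter,
        Nat.cast_sum]
      exact Finset.sum_congr rfl fun b _ => by by_cases h : G'.Adj u b <;> simp [adjInd, h]
    have h2 : (G'.minDegree : ℝ) ≤ G'.degree u := Nat.cast_le.2 (G'.minDegree_le_degree u)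
    rw [h1, Fintype.card_fin]
    linarith
  have hfew' := hfew (Fin n) G G' (by simpa using (le_max_left _ _).trans hn) hG hG' hdeg'
  refine le_trans (Nat.cast_le.2 ?_) hfew'
  rw [← Set.ncard_coe_finset]
  refine Set.ncard_le_ncard (fun v hv => ?_) (Set.toFinite _)
  rw [Finset.mem_coe, Finset.mem_filter]
  refine ⟨Finset.mem_univ _, ?_⟩
  by_contra! hcon
  exact hv.2 (hN' (Fin n) (by simpa using (le_max_right _ _).trans hn) G' v hcon T hv.1
    (by simpa using hT) W H₀ hcol (Nat.le_succ _))
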